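/- Let $G\in\mathbb R^{N\times N}$ be normal ($GG^\top=G^\top G$) and let $\lambda=a+ib$ with $a>0$, $b\ne0$ be an eigenvalue of $G$. Put $\beta=|\mathrm{Im}\sqrt\lambda|$ (principal square root), and for $w\in\mathbb C^N\setminus\{0\}$ with $w^*G=\lambda w^*$ call $w^*x$ the modal component of $x$. (1) First-order gradient play $\dot x=-Gx$ on $[0,\infty)$. Every solution and every such $w$ satisfy $|w^*x(t)|=e^{-at}|w^*x(0)|$: the mode of $\lambda$ decays at rate exactly $a$. The whole system is exponentially stable with decay rate $a$ (that is, $a$ is the largest $r>0$ for which there is $C>0$ with $\|x(t)\|\le Ce^{-rt}\|x(0)\|$ for all solutions and all $t\ge0$) if and only if no eigenvalue of $G$ has real part less than $a$; this is automatic for $N=2$. If all eigenvalues of $G$ have positive real part, the system is exponentially stable with a largest decay rate $r>0$. (2) $\beta=\sqrt{(\sqrt{a^2+b^2}-a)/2}>0$. For every $t_0>0$ the dynamics $\ddot q+\frac3t\dot q+Gq=0$ on $[t_0,\infty)$, with $v=\dot q$, are exponentially unstable with growth rate $\beta$: - the origin is not stable (it is not true that for every $\epsilon>0$ there is $\delta>0$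 such that $\|q(t_0)\|+\|v(t_0)\|<\delta$ implies $\|q(t)\|+\|v(t)\|<\epsilon$ for all $t\ge t_0$); - for every $\epsilon>0$ there is a solution with $\|q(t_0)\|+\|v(t_0)\|<\epsilon$ and $\|q(t)\|=\Theta(t^{-3/2}e^{\beta t})$ as $t\to\infty$; - there is a proper linear subspace $S\subset\mathbb R^N\times\mathbb R^N$ such that every solution with $(q(t_0),v(t_0))\notin S$ satisfies $t^{-3/2}e^{\beta t}=O(\|q(t)\|)$ as $t\to\infty$. Moreover, for every $w$ as above there is a proper linear subspace $S_w\subset\mathbb R^N\times\mathbb R^N$ such that $|w^*q(t)|=\Theta(t^{-3/2}e^{\beta t})$ for every solution with $(q(t_0),v(t_0))\notin S_w$; and if $|\mathrm{Im}\sqrt\mu|\le\beta$ for every eigenvalue $\mu$ of $G$, then every solution satisfies $\|q(t)\|=O(t^{-3/2}e^{\beta t})$. -/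

import Mathlib

open Filter Topology Asymptotics
open scoped Matrix

/-- The (complex) eigenvalues of a real square matrix. -/
def IsComplexEigenvalue {N : ℕ} (G : Matrix (Fin N) (Fin N) ℝ) (μ : ℂ) : Prop :=
  Module.End.HasEigenvalue (Matrix.toLin' (G.map (fun r : ℝ => (r : ℂ)))) μ

/-- `w ≠ 0` and `w* G = μ w*`. -/
def IsLeftEigenvector {N : ℕ} (G : Matrix (Fin N) (Fin N) ℝ) (μ : ℂ) (w : Fin N → ℂ) : Prop :=
  w ≠ 0 ∧ (star w) ᵥ* (G.map (fun r : ℝ => (r : ℂ))) = μ • star w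

/-- The modal projection `w* x`. -/
noncomputable def modal {N : ℕ} (w : Fin N → ℂ) (x : EuclideanSpace ℝ (Fin N)) : ℂ :=
  star w ⬝ᵥ (fun i => (x i : ℂ))

/-- `|Im √μ|` for the principal square root. -/
noncomputable def imSqrt (μ : ℂ) : ℝ := |(μ ^ (1 / 2 : ℂ)).im|

/-- `x` solves `x' = -G x` on `[0, ∞)` (one-sided derivative at the left end). -/
def IsGradientPlay {N : ℕ} (G : Matrix (Fin N) (Fin N) ℝ)
    (x : ℝ → EuclideanSpace ℝ (Fin N)) : Prop :=
  ∀ t : ℝ, 0 ≤ t →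
    HasDerivWithinAt x (-(WithLp.toLp 2 (G *ᵥ (x t).ofLp))) (Set.Ici 0) t

/-- `(q, v)` solves `q' = v`, `v' = -(3/t) v - G q` on `[t₀, ∞)`, the first-order form of
`x'' + (3/t) x' + G x = 0`. -/
def IsNAGD {N : ℕ} (G : Matrix (Fin N) (Fin N) ℝ) (t₀ : ℝ)
    (q v : ℝ → EuclideanSpace ℝ (Fin N)) : Prop :=
  ∀ t : ℝ, t₀ ≤ t →
    HasDerivWithinAt q (v t) (Set.Ici t₀) t ∧
    HasDerivWithinAt v (-((3 / t) • v t) - WithLp.toLp 2 (G *ᵥ (q t).ofLp)) (Set.Ici t₀) t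

/-- The origin is exponentially stable for `x' = -G x`, with rate (at least) `r`. -/
def GradientPlayExpStable {N : ℕ} (G : Matrix (Fin N) (Fin N) ℝ) (r : ℝ) : Prop :=
  0 < r ∧ ∃ C : ℝ, 0 < C ∧ ∀ x : ℝ → EuclideanSpace ℝ (Fin N), IsGradientPlay G x →
    ∀ t : ℝ, 0 ≤ t → ‖x t‖ ≤ C * Real.exp (-r * t) * ‖x 0‖

/-- The origin is exponentially stable for `x' = -G x`, and `r` is the best possible rate. -/
def GradientPlayDecayRate {N : ℕ} (G : Matrix (Fin N) (Fin N) ℝ) (r : ℝ) : Prop :=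
  IsGreatest {s : ℝ | GradientPlayExpStable G s} r

/-- The origin is a stable equilibrium of the NAGD dynamics started at time `t₀`. -/
def NAGDStable {N : ℕ} (G : Matrix (Fin N) (Fin N) ℝ) (t₀ : ℝ) : Prop :=
  ∀ ε : ℝ, 0 < ε → ∃ δ : ℝ, 0 < δ ∧ ∀ q v : ℝ → EuclideanSpace ℝ (Fin N), IsNAGD G t₀ q v →
    ‖q t₀‖ + ‖v t₀‖ < δ → ∀ t : ℝ, t₀ ≤ t → ‖q t‖ + ‖v t‖ < ε

/-- The comparison function `t^(-3/2) e^(β t)`: exponential growth at rate `β` up to the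
algebraic factor that the damping `3/t` produces. -/
noncomputable def dampedExp (β t : ℝ) : ℝ := t ^ (-(3 / 2) : ℝ) * Real.exp (β * t)

/-- The NAGD dynamics started at `t₀` are exponentially unstable with growth rate `β`:
the origin is not stable; arbitrarily small initial data lead to trajectories of growth rate
exactly `β`; and outside a proper linear subspace of initial data every trajectory grows at
least at that rate. -/
def NAGDExpUnstable {N : ℕ} (G : Matrix (Fin N) (Fin N) ℝ) (t₀ β : ℝ) : Prop :=
  0 < β ∧
  ¬ NAGDStable G t₀ ∧
  (∀ ε : ℝ, 0 < ε → ∃ q v : ℝ → EuclideanSpace ℝ (Fin N), IsNAGD G t₀ q v ∧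
    ‖q t₀‖ + ‖v t₀‖ < ε ∧ (fun t => ‖q t‖) =Θ[atTop] dampedExp β) ∧
  (∃ S : Submodule ℝ (EuclideanSpace ℝ (Fin N) × EuclideanSpace ℝ (Fin N)), S ≠ ⊤ ∧
    ∀ q v : ℝ → EuclideanSpace ℝ (Fin N), IsNAGD G t₀ q v → (q t₀, v t₀) ∉ S →
      dampedExp β =O[atTop] (fun t => ‖q t‖))

/-! For normal `G` the left eigenvectors span `ℂ^N`, so both dynamics decouple into scalar modes
`w*x`. Gradient play gives `y' = -μ y`, hence decay exactly `e^{-(Re μ) t}`; the best rate of the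
system is the least real part in the spectrum.

The accelerated dynamics give `y'' + (3/t) y' + μ y = 0`. With `s² = -μ`, `Re s = |Im √μ|` and `u =
t^(3/2) y` this becomes `u'' = (s² + 3/(4t²)) u`. The factors `P = u' + s u` and `M = u' - s u`
satisfy a diagonal system with an `O(1/t²)` coupling. The coupling is integrable, so `|P|² + |M|²`
is `O(e^{2 (Re s) t})`. When `Re s > 0`, the gap `|P|² - |M|²`, once positive at a late time, grows
like `e^{2 (Re s) t}`; if it never becomes positive, `P` and `M` tend to zero. Each mode is
therefore recessive or of exact order `t^(-3/2) e^{(Re s) t}`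
(`IsScalarNAGD.tendsto_zero_or_isTheta`).

It remains to see that not every solution is recessive. The solution regular at `t = 0`, a Bessel
series, is not: its flux `t³ Im(y' ȳ)` is monotone and vanishes at `0`, and would vanish at infinity
too, forcing `y = 0` against `y(0) = 1`. This uses `Im μ ≠ 0`. Recessive data thus form a proper
subspace, which is pulled back along `w*`. Real unstable trajectories are `Re(y u)` with `u` an
eigenvector; `u` is isotropic for the bilinear product, so no cancellation with the conjugate mode
occurs. -/

/-! ### Calculus on half-lines -/

theorem antitoneOn_Ici_of_hasDerivWithinAt_nonpos {f f' : ℝ → ℝ} {a : ℝ}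
    (h : ∀ t, a ≤ t → HasDerivWithinAt f (f' t) (Set.Ici a) t) (h0 : ∀ t, a ≤ t → f' t ≤ 0) :
    AntitoneOn f (Set.Ici a) := by
  refine antitoneOn_of_hasDerivWithinAt_nonpos (f' := f') (convex_Ici a)
    (fun t ht => (h t ht).continuousWithinAt) (fun t ht => ?_) (fun t ht => ?_)
  · rw [interior_Ici] at ht ⊢
    exact (h t (le_of_lt ht)).mono Set.Ioi_subset_Ici_self
  · rw [interior_Ici] at ht
    exact h0 t (le_of_lt ht)

theorem monotoneOn_Ici_of_hasDerivWithinAt_nonneg {f f' : ℝ → ℝ} {a : ℝ}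
    (h : ∀ t, a ≤ t → HasDerivWithinAt f (f' t) (Set.Ici a) t) (h0 : ∀ t, a ≤ t → 0 ≤ f' t) :
    MonotoneOn f (Set.Ici a) := by
  have := antitoneOn_Ici_of_hasDerivWithinAt_nonpos (f := fun t => -f t) (f' := fun t => -f' t)
    (fun t ht => (h t ht).neg) (fun t ht => by have := h0 t ht; linarith)
  intro x hx y hy hxy
  have := this hx hy hxy
  simp only at this
  linarith

theorem eq_of_hasDerivWithinAt_Ici_zero {E : Type*} [NormedAddCommGroup E] [NormedSpace ℝ E]
    {f : ℝ → E} {a : ℝ} (h : ∀ t, a ≤ t → HasDerivWithinAt f 0 (Set.Ici a) t) (t : ℝ)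
    (ht : a ≤ t) : f t = f a :=
  constant_of_has_deriv_right_zero
    (fun x hx => (h x hx.1).continuousWithinAt.mono Set.Icc_subset_Ici_self)
    (fun x hx => (h x hx.1).mono (Set.Ici_subset_Ici.2 hx.1)) t (Set.right_mem_Icc.2 ht)

theorem Complex.real_inner_mul_self (s p : ℂ) : inner ℝ p (s * p) = s.re * ‖p‖ ^ 2 := by
  rw [Complex.inner, ← Complex.normSq_eq_norm_sq, Complex.normSq_apply]
  simp
  ring

theorem Complex.abs_real_inner_mul_sub_le (c p q m : ℂ) :
    |inner ℝ q (c * (p - m))| ≤ ‖q‖ * (‖c‖ * (‖p‖ + ‖m‖)) := by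
  refine (abs_real_inner_le_norm _ _).trans ?_
  rw [norm_mul]
  gcongr
  exact norm_sub_le _ _

/-! ### Dichotomy for a diagonal planar system with `O(1/t²)` coupling -/

/-- The planar system `P' = s P + (k/t²)(P - M)`, `M' = -s M + (k/t²)(P - M)` on `[t₀, ∞)`. -/
def IsSplitSystem (s k : ℂ) (t₀ : ℝ) (P M : ℝ → ℂ) : Prop :=
  ∀ t : ℝ, t₀ ≤ t →
    HasDerivWithinAt P (s * P t + k / (t : ℂ) ^ 2 * (P t - M t)) (Set.Ici t₀) t ∧
    HasDerivWithinAt M (-s * M t + k / (t : ℂ) ^ 2 * (P t - M t)) (Set.Ici t₀) t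

namespace IsSplitSystem

variable {s k : ℂ} {t₀ : ℝ} {P M : ℝ → ℂ}

theorem mono (h : IsSplitSystem s k t₀ P M) {t₁ : ℝ} (h1 : t₀ ≤ t₁) :
    IsSplitSystem s k t₁ P M := fun t ht =>
  ⟨(h t (h1.trans ht)).1.mono (Set.Ici_subset_Ici.2 h1),
    (h t (h1.trans ht)).2.mono (Set.Ici_subset_Ici.2 h1)⟩

theorem exists_hasDerivWithinAt_norm_sq (h : IsSplitSystem s k t₀ P M) {t : ℝ} (ht : t₀ ≤ t) :
    ∃ r₁ r₂ : ℝ, |r₁| ≤ ‖P t‖ * (‖k‖ / t ^ 2 * (‖P t‖ + ‖M t‖)) ∧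
      |r₂| ≤ ‖M t‖ * (‖k‖ / t ^ 2 * (‖P t‖ + ‖M t‖)) ∧
      HasDerivWithinAt (fun t => ‖P t‖ ^ 2) (2 * (s.re * ‖P t‖ ^ 2 + r₁)) (Set.Ici t₀) t ∧
      HasDerivWithinAt (fun t => ‖M t‖ ^ 2) (2 * (-s.re * ‖M t‖ ^ 2 + r₂)) (Set.Ici t₀) t := by
  have hk : ‖k / (t : ℂ) ^ 2‖ = ‖k‖ / t ^ 2 := by
    rw [norm_div, norm_pow, Complex.norm_real, Real.norm_eq_abs, sq_abs]
  refine ⟨inner ℝ (P t) (k / (t : ℂ) ^ 2 * (P t - M t)),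
    inner ℝ (M t) (k / (t : ℂ) ^ 2 * (P t - M t)), ?_, ?_, ?_, ?_⟩
  · rw [← hk]; exact Complex.abs_real_inner_mul_sub_le _ _ _ _
  · rw [← hk]; exact Complex.abs_real_inner_mul_sub_le _ _ _ _
  · have := (h t ht).1.norm_sq
    rwa [inner_add_right, Complex.real_inner_mul_self] at this
  · have := (h t ht).2.norm_sq
    rwa [inner_add_right, Complex.real_inner_mul_self, Complex.neg_re] at this

end IsSplitSystem

theorem hasDerivAt_exp_linear_add_div (β K : ℝ) {t : ℝ} (ht : t ≠ 0) :
    HasDerivAt (fun t : ℝ => Real.exp (β * t + K / t))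
      (Real.exp (β * t + K / t) * (β - K / t ^ 2)) t := by
  have h1 : HasDerivAt (fun t : ℝ => β * t + K / t) (β - K / t ^ 2) t := by
    simp only [div_eq_mul_inv]
    exact (((hasDerivAt_id t).const_mul β).add ((hasDerivAt_inv ht).const_mul K)).congr_deriv
      (by ring)
  exact h1.exp

namespace IsSplitSystem

variable {s k : ℂ} {t₀ : ℝ} {P M : ℝ → ℂ}

/-- The coupling contributes at most `2c(|P| + |M|)² ≤ 4c(|P|² + |M|²)` with `c = ‖k‖/t²`. The term
`4‖k‖/t` in the exponent has derivative `-4c` and absorbs this; being bounded, it costs no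
exponential rate. -/
theorem antitoneOn_energy (h : IsSplitSystem s k t₀ P M) (ht₀ : 0 < t₀) (hs : 0 ≤ s.re) :
    AntitoneOn (fun t => (‖P t‖ ^ 2 + ‖M t‖ ^ 2) *
      Real.exp (-(2 * s.re) * t + 4 * ‖k‖ / t)) (Set.Ici t₀) := by
  have key : ∀ t : ℝ, ∃ d : ℝ, t₀ ≤ t → HasDerivWithinAt (fun t => (‖P t‖ ^ 2 + ‖M t‖ ^ 2) *
      Real.exp (-(2 * s.re) * t + 4 * ‖k‖ / t)) d (Set.Ici t₀) t ∧ d ≤ 0 := by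
    intro t
    by_cases ht : t₀ ≤ t
    swap
    · exact ⟨0, fun h => absurd h ht⟩
    obtain ⟨r₁, r₂, h1, h2, h3, h4⟩ := h.exists_hasDerivWithinAt_norm_sq ht
    have htp : 0 < t := ht₀.trans_le ht
    refine ⟨_, fun _ => ⟨(h3.add h4).mul
      (hasDerivAt_exp_linear_add_div (-(2 * s.re)) (4 * ‖k‖) htp.ne').hasDerivWithinAt, ?_⟩⟩
    set E := Real.exp (-(2 * s.re) * t + 4 * ‖k‖ / t)
    have hE : 0 < E := Real.exp_pos _
    rw [show 4 * ‖k‖ / t ^ 2 = 4 * (‖k‖ / t ^ 2) by ring]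
    set c := ‖k‖ / t ^ 2
    have hc : 0 ≤ c := by positivity
    have e1 := (abs_le.1 h1).2
    have e2 := (abs_le.1 h2).2
    have h5 : 2 * (s.re * ‖P t‖ ^ 2 + r₁) + 2 * (-s.re * ‖M t‖ ^ 2 + r₂)
        + (‖P t‖ ^ 2 + ‖M t‖ ^ 2) * (-(2 * s.re) - 4 * c) ≤ 0 := by
      nlinarith [mul_nonneg hc (sq_nonneg (‖P t‖ - ‖M t‖)), mul_nonneg hs (sq_nonneg ‖M t‖)]
    have := mul_nonpos_of_nonneg_of_nonpos hE.le h5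
    simp only [Pi.add_apply]
    linarith
  choose d hd using key
  exact antitoneOn_Ici_of_hasDerivWithinAt_nonpos (fun t ht => (hd t ht).1)
    (fun t ht => (hd t ht).2)

theorem eq_zero_of_initial (h : IsSplitSystem s k t₀ P M) (ht₀ : 0 < t₀) (hs : 0 ≤ s.re)
    (hP : P t₀ = 0) (hM : M t₀ = 0) {t : ℝ} (ht : t₀ ≤ t) : P t = 0 ∧ M t = 0 := by
  have h1 := h.antitoneOn_energy ht₀ hs Set.self_mem_Ici ht ht
  simp only [hP, hM, norm_zero] at h1
  have h2 : ‖P t‖ ^ 2 + ‖M t‖ ^ 2 ≤ 0 := by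
    refine nonpos_of_mul_nonpos_left (h1.trans (by norm_num)) (Real.exp_pos _)
  constructor <;> rw [← norm_eq_zero] <;> nlinarith [sq_nonneg ‖P t‖, sq_nonneg ‖M t‖]

theorem exists_norm_le (h : IsSplitSystem s k t₀ P M) (ht₀ : 0 < t₀) (hs : 0 ≤ s.re) :
    ∃ C : ℝ, 0 < C ∧ ∀ t, t₀ ≤ t →
      ‖P t‖ ≤ C * Real.exp (s.re * t) ∧ ‖M t‖ ≤ C * Real.exp (s.re * t) := by
  set A := (‖P t₀‖ ^ 2 + ‖M t₀‖ ^ 2) * Real.exp (-(2 * s.re) * t₀ + 4 * ‖k‖ / t₀) with hA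
  have hA0 : 0 ≤ A := by positivity
  refine ⟨√A + 1, by positivity, fun t ht => ?_⟩
  have h1 := h.antitoneOn_energy ht₀ hs Set.self_mem_Ici ht ht
  have htp : 0 < t := ht₀.trans_le ht
  have h2 : (‖P t‖ ^ 2 + ‖M t‖ ^ 2) ≤ A * Real.exp (s.re * t) ^ 2 := by
    have h3 : Real.exp (-(2 * s.re) * t) ≤ Real.exp (-(2 * s.re) * t + 4 * ‖k‖ / t) := by
      gcongr
      have : 0 ≤ 4 * ‖k‖ / t := by positivity
      linarith
    have h4 : (‖P t‖ ^ 2 + ‖M t‖ ^ 2) * Real.exp (-(2 * s.re) * t) ≤ A :=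
      (mul_le_mul_of_nonneg_left h3 (by positivity)).trans h1
    have h5 : Real.exp (-(2 * s.re) * t) * Real.exp (s.re * t) ^ 2 = 1 := by
      rw [← Real.exp_nat_mul, ← Real.exp_add]
      norm_num
      ring
    calc _ = (‖P t‖ ^ 2 + ‖M t‖ ^ 2) * (Real.exp (-(2 * s.re) * t) * Real.exp (s.re * t) ^ 2) := by
            rw [h5, mul_one]
      _ = ((‖P t‖ ^ 2 + ‖M t‖ ^ 2) * Real.exp (-(2 * s.re) * t)) * Real.exp (s.re * t) ^ 2 := by
            ring
      _ ≤ _ := by gcongr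
  have h6 : A * Real.exp (s.re * t) ^ 2 ≤ ((√A + 1) * Real.exp (s.re * t)) ^ 2 := by
    rw [mul_pow]
    gcongr
    nlinarith [Real.sq_sqrt hA0, Real.sqrt_nonneg A]
  constructor
  · refine le_of_sq_le_sq ?_ (by positivity)
    nlinarith [sq_nonneg ‖M t‖]
  · refine le_of_sq_le_sq ?_ (by positivity)
    nlinarith [sq_nonneg ‖P t‖]

/-- After the weight, the derivative is at least `(4 Re s - 8c)|M|²`, where `c = ‖k‖/t²`. The
hypothesis on `t₀` makes `4c ≤ Re s`, more than enough for it to be nonnegative. -/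
theorem monotoneOn_gap (h : IsSplitSystem s k t₀ P M) (ht₀ : 0 < t₀)
    (hk : 4 * ‖k‖ ≤ s.re * t₀ ^ 2) :
    MonotoneOn (fun t => (‖P t‖ ^ 2 - ‖M t‖ ^ 2) *
      Real.exp (-(2 * s.re) * t + (-(4 * ‖k‖)) / t)) (Set.Ici t₀) := by
  have key : ∀ t : ℝ, ∃ d : ℝ, t₀ ≤ t → HasDerivWithinAt (fun t => (‖P t‖ ^ 2 - ‖M t‖ ^ 2) *
      Real.exp (-(2 * s.re) * t + (-(4 * ‖k‖)) / t)) d (Set.Ici t₀) t ∧ 0 ≤ d := by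
    intro t
    by_cases ht : t₀ ≤ t
    swap
    · exact ⟨0, fun h => absurd h ht⟩
    obtain ⟨r₁, r₂, h1, h2, h3, h4⟩ := h.exists_hasDerivWithinAt_norm_sq ht
    have htp : 0 < t := ht₀.trans_le ht
    refine ⟨_, fun _ => ⟨(h3.sub h4).mul
      (hasDerivAt_exp_linear_add_div (-(2 * s.re)) (-(4 * ‖k‖)) htp.ne').hasDerivWithinAt, ?_⟩⟩
    set E := Real.exp (-(2 * s.re) * t + (-(4 * ‖k‖)) / t)
    have hE : 0 < E := Real.exp_pos _
    have hs : 0 ≤ s.re := by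
      by_contra! hs
      nlinarith [norm_nonneg k, mul_pos ht₀ ht₀]
    have hcs : 4 * (‖k‖ / t ^ 2) ≤ s.re := by
      rw [← mul_div_assoc, div_le_iff₀ (by positivity)]
      exact hk.trans (by gcongr)
    rw [show -(4 * ‖k‖) / t ^ 2 = -(4 * (‖k‖ / t ^ 2)) by ring]
    set c := ‖k‖ / t ^ 2
    have hc : 0 ≤ c := by positivity
    have e1 := (abs_le.1 h1).1
    have e2 := (abs_le.1 h2).2
    have h5 : 0 ≤ 2 * (s.re * ‖P t‖ ^ 2 + r₁) - 2 * (-s.re * ‖M t‖ ^ 2 + r₂)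
        + (‖P t‖ ^ 2 - ‖M t‖ ^ 2) * (-(2 * s.re) - -(4 * c)) := by
      nlinarith [mul_nonneg hc (sq_nonneg (‖P t‖ - ‖M t‖)),
        mul_nonneg (sub_nonneg.2 hcs) (sq_nonneg ‖M t‖), mul_nonneg hc (sq_nonneg ‖M t‖)]
    have := mul_nonneg hE.le h5
    simp only [Pi.sub_apply]
    linarith
  choose d hd using key
  exact monotoneOn_Ici_of_hasDerivWithinAt_nonneg (fun t ht => (hd t ht).1)
    (fun t ht => (hd t ht).2)

/-- When `M` dominates, the coupling adds at most `4c|M|² ≤ (Re s)|M|²` to `-2(Re s)|M|²`, so half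
of the decay survives. The `0 / t` only matches the shape of `hasDerivAt_exp_linear_add_div`. -/
theorem antitoneOn_recessive (h : IsSplitSystem s k t₀ P M) (ht₀ : 0 < t₀)
    (hk : 4 * ‖k‖ ≤ s.re * t₀ ^ 2) (hPM : ∀ t, t₀ ≤ t → ‖P t‖ ≤ ‖M t‖) :
    AntitoneOn (fun t => ‖M t‖ ^ 2 * Real.exp (s.re * t + 0 / t)) (Set.Ici t₀) := by
  have key : ∀ t : ℝ, ∃ d : ℝ, t₀ ≤ t → HasDerivWithinAt (fun t => ‖M t‖ ^ 2 *
      Real.exp (s.re * t + 0 / t)) d (Set.Ici t₀) t ∧ d ≤ 0 := by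
    intro t
    by_cases ht : t₀ ≤ t
    swap
    · exact ⟨0, fun h => absurd h ht⟩
    obtain ⟨r₁, r₂, h1, h2, h3, h4⟩ := h.exists_hasDerivWithinAt_norm_sq ht
    have htp : 0 < t := ht₀.trans_le ht
    refine ⟨_, fun _ => ⟨h4.mul
      (hasDerivAt_exp_linear_add_div s.re 0 htp.ne').hasDerivWithinAt, ?_⟩⟩
    set E := Real.exp (s.re * t + 0 / t)
    have hE : 0 < E := Real.exp_pos _
    have hs : 0 ≤ s.re := by
      by_contra! hs
      nlinarith [norm_nonneg k, mul_pos ht₀ ht₀]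
    have hcs : 4 * (‖k‖ / t ^ 2) ≤ s.re := by
      rw [← mul_div_assoc, div_le_iff₀ (by positivity)]
      exact hk.trans (by gcongr)
    rw [zero_div, sub_zero]
    set c := ‖k‖ / t ^ 2
    have hc : 0 ≤ c := by positivity
    have e2 := (abs_le.1 h2).2
    have h5 : 2 * (-s.re * ‖M t‖ ^ 2 + r₂) + ‖M t‖ ^ 2 * s.re ≤ 0 := by
      have := mul_le_mul_of_nonneg_left (hPM t ht) (mul_nonneg hc (norm_nonneg (M t)))
      nlinarith [mul_nonneg (sub_nonneg.2 hcs) (sq_nonneg ‖M t‖)]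
    have := mul_nonpos_of_nonneg_of_nonpos hE.le h5
    linarith
  choose d hd using key
  exact antitoneOn_Ici_of_hasDerivWithinAt_nonpos (fun t ht => (hd t ht).1)
    (fun t ht => (hd t ht).2)

theorem tendsto_zero_of_le (h : IsSplitSystem s k t₀ P M) (ht₀ : 0 < t₀) (hs : 0 < s.re)
    (hk : 4 * ‖k‖ ≤ s.re * t₀ ^ 2) (hPM : ∀ t, t₀ ≤ t → ‖P t‖ ≤ ‖M t‖) :
    Tendsto P atTop (𝓝 0) ∧ Tendsto M atTop (𝓝 0) := by
  have hM : Tendsto (fun t => ‖M t‖ ^ 2) atTop (𝓝 0) := by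
    set A := ‖M t₀‖ ^ 2 * Real.exp (s.re * t₀ + 0 / t₀)
    have hlim : Tendsto (fun t : ℝ => A * Real.exp (-(s.re * t))) atTop (𝓝 (A * 0)) :=
      (Real.tendsto_exp_neg_atTop_nhds_zero.comp
        (tendsto_id.const_mul_atTop hs)).const_mul A
    rw [mul_zero] at hlim
    refine squeeze_zero' (Eventually.of_forall fun t => by positivity) ?_ hlim
    filter_upwards [eventually_ge_atTop t₀] with t ht
    have h1 := h.antitoneOn_recessive ht₀ hk hPM Set.self_mem_Ici ht ht
    simp only at h1
    rw [Real.exp_neg, ← div_eq_mul_inv, le_div_iff₀ (Real.exp_pos _)]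
    simpa only [zero_div, add_zero, A] using h1
  have hM' : Tendsto (fun t => ‖M t‖) atTop (𝓝 0) := by
    simpa using hM.sqrt
  refine ⟨squeeze_zero_norm' ?_ hM', tendsto_zero_iff_norm_tendsto_zero.2 hM'⟩
  filter_upwards [eventually_ge_atTop t₀] with t ht using hPM t ht

/-- Either the system is recessive, or `P - M` grows like `e^{(Re s) t}`. -/
theorem tendsto_zero_or_isTheta (h : IsSplitSystem s k t₀ P M) (ht₀ : 0 < t₀) (hs : 0 < s.re) :
    (Tendsto P atTop (𝓝 0) ∧ Tendsto M atTop (𝓝 0)) ∨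
      (fun t => P t - M t) =Θ[atTop] fun t => Real.exp (s.re * t) := by
  obtain ⟨T, hT₀, hT⟩ : ∃ T, t₀ ≤ T ∧ 4 * ‖k‖ ≤ s.re * T ^ 2 := by
    have h1 : Tendsto (fun T : ℝ => s.re * T ^ 2) atTop atTop :=
      (tendsto_pow_atTop two_ne_zero).const_mul_atTop hs
    exact ((eventually_ge_atTop t₀).and (h1.eventually_ge_atTop (4 * ‖k‖))).exists
  have hTp : 0 < T := ht₀.trans_le hT₀
  have hm := h.mono hT₀
  by_cases hPM : ∀ t, T ≤ t → ‖P t‖ ≤ ‖M t‖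
  · exact Or.inl (hm.tendsto_zero_of_le hTp hs hT hPM)
  right
  push Not at hPM
  obtain ⟨t₁, ht₁, hlt⟩ := hPM
  obtain ⟨C, hC, hbd⟩ := h.exists_norm_le ht₀ hs.le
  constructor
  · refine IsBigO.of_bound (2 * C) ?_
    filter_upwards [eventually_ge_atTop t₀] with t ht
    rw [Real.norm_of_nonneg (Real.exp_pos _).le]
    refine (norm_sub_le _ _).trans ?_
    have := hbd t ht
    linarith
  -- The weighted gap is positive at `t₁` and stays at least `c`. Factoring the gap as `(|P| -
  -- |M|)(|P| + |M|)` and bounding the second factor by `2C e^{(Re s) t}` turns this quadratic lower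
  -- bound into one for `|P - M|`.
  · set c := (‖P t₁‖ ^ 2 - ‖M t₁‖ ^ 2) * Real.exp (-(2 * s.re) * t₁ + (-(4 * ‖k‖)) / t₁)
    have hc : 0 < c := by
      refine mul_pos ?_ (Real.exp_pos _)
      nlinarith [norm_nonneg (M t₁)]
    refine IsBigO.of_bound (2 * C / c) ?_
    filter_upwards [eventually_ge_atTop t₁] with t ht
    have htp : 0 < t := hTp.trans_le (ht₁.trans ht)
    have h1 := hm.monotoneOn_gap hTp hT ht₁ (ht₁.trans ht) ht
    simp only at h1
    have hgap : 0 < ‖P t‖ ^ 2 - ‖M t‖ ^ 2 :=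
      pos_of_mul_pos_left (hc.trans_le h1) (Real.exp_pos _).le
    have h3 : Real.exp (-(2 * s.re) * t + (-(4 * ‖k‖)) / t) ≤ Real.exp (-(2 * s.re) * t) := by
      gcongr
      have : -(4 * ‖k‖) / t ≤ 0 := div_nonpos_of_nonpos_of_nonneg (by simp) htp.le
      linarith
    have h4 : c ≤ (‖P t‖ ^ 2 - ‖M t‖ ^ 2) * Real.exp (-(2 * s.re) * t) :=
      h1.trans (mul_le_mul_of_nonneg_left h3 hgap.le)
    set e := Real.exp (s.re * t)
    have he : 0 < e := Real.exp_pos _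
    have h5 : Real.exp (-(2 * s.re) * t) = (e ^ 2)⁻¹ := by
      rw [← Real.exp_nat_mul, ← Real.exp_neg]
      norm_num
      ring
    rw [h5, ← div_eq_mul_inv, le_div_iff₀ (by positivity)] at h4
    have h6 : ‖P t‖ - ‖M t‖ ≤ ‖P t - M t‖ := norm_sub_norm_le _ _
    have h7 := hbd t (hT₀.trans (ht₁.trans ht))
    have h8 : ‖P t‖ ^ 2 - ‖M t‖ ^ 2 ≤ ‖P t - M t‖ * (2 * C * e) := by
      have : ‖P t‖ ^ 2 - ‖M t‖ ^ 2 = (‖P t‖ - ‖M t‖) * (‖P t‖ + ‖M t‖) := by ring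
      rw [this]
      refine mul_le_mul h6 (by linarith) (by positivity) (norm_nonneg _)
    rw [Real.norm_of_nonneg he.le, div_mul_eq_mul_div, le_div_iff₀ hc]
    refine le_of_mul_le_mul_right ?_ he
    nlinarith

end IsSplitSystem

/-! ### The scalar equation and its Liouville transform -/

/-- `(y, z)` solves the scalar equation `y' = z`, `z' = -(3/t) z - μ y` on `[t₀, ∞)`. -/
def IsScalarNAGD (μ : ℂ) (t₀ : ℝ) (y z : ℝ → ℂ) : Prop :=
  ∀ t : ℝ, t₀ ≤ t →
    HasDerivWithinAt y (z t) (Set.Ici t₀) t ∧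
    HasDerivWithinAt z (-(3 / (t : ℂ) * z t) - μ * y t) (Set.Ici t₀) t

/-- `t^(3/2)` as a complex number. -/
noncomputable def liouvilleWeight (t : ℝ) : ℂ := ((t ^ (3 / 2 : ℝ) : ℝ) : ℂ)

/-- The factor `t^(3/2) (z + (3/(2t) + s) y)` of the Liouville transform of the scalar equation. -/
noncomputable def splitFactor (s : ℂ) (y z : ℝ → ℂ) (t : ℝ) : ℂ :=
  liouvilleWeight t * (z t + (3 / (2 * (t : ℂ)) + s) * y t)

theorem liouvilleWeight_ne_zero {t : ℝ} (ht : 0 < t) : liouvilleWeight t ≠ 0 :=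
  Complex.ofReal_ne_zero.2 (Real.rpow_pos_of_pos ht _).ne'

theorem norm_liouvilleWeight {t : ℝ} (ht : 0 < t) : ‖liouvilleWeight t‖ = t ^ (3 / 2 : ℝ) := by
  rw [liouvilleWeight, Complex.norm_real, Real.norm_of_nonneg (Real.rpow_nonneg ht.le _)]

theorem hasDerivAt_liouvilleWeight {t : ℝ} (ht : 0 < t) :
    HasDerivAt liouvilleWeight (3 / (2 * (t : ℂ)) * liouvilleWeight t) t := by
  have h := (Real.hasDerivAt_rpow_const (x := t) (p := 3 / 2) (Or.inl ht.ne')).ofReal_comp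
  refine h.congr_deriv ?_
  rw [Real.rpow_sub_one ht.ne', liouvilleWeight]
  push_cast
  field_simp

theorem splitFactor_sub (s : ℂ) (y z : ℝ → ℂ) (t : ℝ) :
    splitFactor s y z t - splitFactor (-s) y z t = 2 * s * (liouvilleWeight t * y t) := by
  simp only [splitFactor]
  ring

theorem splitFactor_add (s : ℂ) (y z : ℝ → ℂ) (t : ℝ) :
    splitFactor s y z t + splitFactor (-s) y z t =
      2 * (liouvilleWeight t * z t) + 3 / (t : ℂ) * (liouvilleWeight t * y t) := by
  simp only [splitFactor]
  field_simp
  ring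

theorem dampedExp_pos (β : ℝ) {t : ℝ} (ht : 0 < t) : 0 < dampedExp β t := by
  unfold dampedExp
  positivity

theorem dampedExp_isBigO_of_le {α β : ℝ} (h : α ≤ β) : dampedExp α =O[atTop] dampedExp β := by
  refine IsBigO.of_bound 1 ?_
  filter_upwards [eventually_gt_atTop 0] with t ht
  rw [Real.norm_of_nonneg (dampedExp_pos α ht).le, Real.norm_of_nonneg (dampedExp_pos β ht).le,
    one_mul]
  unfold dampedExp
  gcongr

theorem one_isBigO_dampedExp {β : ℝ} (h : 0 < β) :
    (fun _ : ℝ => (1 : ℝ)) =O[atTop] dampedExp β := by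
  have h1 := tendsto_exp_mul_div_rpow_atTop (3 / 2) β h
  refine IsBigO.of_bound 1 ?_
  filter_upwards [h1.eventually_ge_atTop 1, eventually_gt_atTop 0] with t ht htp
  rw [Real.norm_of_nonneg (dampedExp_pos β htp).le, norm_one, one_mul, dampedExp,
    Real.rpow_neg htp.le, mul_comm, ← div_eq_mul_inv]
  exact ht

theorem tendsto_dampedExp_atTop {β : ℝ} (h : 0 < β) : Tendsto (dampedExp β) atTop atTop := by
  refine (tendsto_exp_mul_div_rpow_atTop (3 / 2) β h).congr' ?_
  filter_upwards [eventually_gt_atTop 0] with t htp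
  rw [dampedExp, Real.rpow_neg htp.le, mul_comm (_⁻¹), ← div_eq_mul_inv]

theorem liouvilleWeight_mul_dampedExp (β : ℝ) {t : ℝ} (ht : 0 < t) :
    ‖liouvilleWeight t‖ * dampedExp β t = Real.exp (β * t) := by
  rw [norm_liouvilleWeight ht, dampedExp, ← mul_assoc, ← Real.rpow_add ht]
  norm_num

namespace IsScalarNAGD

variable {μ s : ℂ} {t₀ : ℝ} {y z : ℝ → ℂ}

theorem add (h : IsScalarNAGD μ t₀ y z) {y' z' : ℝ → ℂ} (h' : IsScalarNAGD μ t₀ y' z') :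
    IsScalarNAGD μ t₀ (fun t => y t + y' t) (fun t => z t + z' t) := fun t ht =>
  ⟨(h t ht).1.add (h' t ht).1, ((h t ht).2.add (h' t ht).2).congr_deriv (by ring)⟩

theorem const_mul (h : IsScalarNAGD μ t₀ y z) (c : ℂ) :
    IsScalarNAGD μ t₀ (fun t => c * y t) (fun t => c * z t) := fun t ht =>
  ⟨(h t ht).1.const_mul c, ((h t ht).2.const_mul c).congr_deriv (by ring)⟩

/-- With `u = t^(3/2) y` the factor is `u' + s u`, and `u'' = (s² + 3/(4t²)) u`. -/
theorem hasDerivWithinAt_splitFactor (h : IsScalarNAGD μ t₀ y z) (ht₀ : 0 < t₀)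
    (hs : s ^ 2 = -μ) {t : ℝ} (ht : t₀ ≤ t) :
    HasDerivWithinAt (splitFactor s y z) (s * splitFactor s y z t +
      3 / (4 * (t : ℂ) ^ 2) * (liouvilleWeight t * y t)) (Set.Ici t₀) t := by
  have htp : 0 < t := ht₀.trans_le ht
  have htc : (t : ℂ) ≠ 0 := Complex.ofReal_ne_zero.2 htp.ne'
  have h1 : HasDerivAt (fun t : ℝ => 3 / (2 * (t : ℂ)) + s) (-3 / (2 * (t : ℂ) ^ 2)) t := by
    have h2 : HasDerivAt (fun t : ℝ => (t : ℂ)) 1 t := (hasDerivAt_id t).ofReal_comp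
    refine (((hasDerivAt_const t (3 : ℂ)).div (h2.const_mul 2)
      (by simpa using htc)).add_const s).congr_deriv ?_
    field_simp
    ring
  refine ((hasDerivAt_liouvilleWeight htp).hasDerivWithinAt.mul
    ((h t ht).2.add (h1.hasDerivWithinAt.mul (h t ht).1))).congr_deriv ?_
  have hμ : μ = -s ^ 2 := by rw [hs, neg_neg]
  simp only [splitFactor, hμ, Pi.add_apply, Pi.mul_apply]
  field_simp
  ring

/-- The constant `3/(8s)` comes from substituting `u = (P - M)/(2s)` into `3/(4t²) u`. -/
theorem isSplitSystem (h : IsScalarNAGD μ t₀ y z) (ht₀ : 0 < t₀) (hs : s ^ 2 = -μ) (h0 : s ≠ 0) :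
    IsSplitSystem s (3 / (8 * s)) t₀ (splitFactor s y z) (splitFactor (-s) y z) := by
  intro t ht
  have htc : (t : ℂ) ≠ 0 := Complex.ofReal_ne_zero.2 (ht₀.trans_le ht).ne'
  refine ⟨(h.hasDerivWithinAt_splitFactor ht₀ hs ht).congr_deriv ?_,
    (h.hasDerivWithinAt_splitFactor ht₀ (s := -s) (by rw [neg_sq, hs]) ht).congr_deriv ?_⟩
  all_goals
    rw [splitFactor_sub]
    field_simp
    ring

theorem isBigO (h : IsScalarNAGD μ t₀ y z) (ht₀ : 0 < t₀) (hs : s ^ 2 = -μ) (h0 : s ≠ 0)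
    (hre : 0 ≤ s.re) : y =O[atTop] dampedExp s.re := by
  obtain ⟨C, hC, hb⟩ := (h.isSplitSystem ht₀ hs h0).exists_norm_le ht₀ hre
  refine IsBigO.of_bound (C / ‖s‖) ?_
  filter_upwards [eventually_ge_atTop t₀] with t ht
  have htp := ht₀.trans_le ht
  rw [Real.norm_of_nonneg (dampedExp_pos _ htp).le]
  have h1 : ‖splitFactor s y z t - splitFactor (-s) y z t‖ ≤ 2 * C * Real.exp (s.re * t) := by
    refine (norm_sub_le _ _).trans ?_
    have := hb t ht
    linarith
  rw [splitFactor_sub, ← liouvilleWeight_mul_dampedExp _ htp] at h1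
  simp only [norm_mul, Complex.norm_ofNat] at h1
  have hw : 0 < ‖liouvilleWeight t‖ := norm_pos_iff.2 (liouvilleWeight_ne_zero htp)
  have hsn : 0 < ‖s‖ := norm_pos_iff.2 h0
  rw [div_mul_eq_mul_div, le_div_iff₀ hsn]
  refine le_of_mul_le_mul_left ?_ hw
  linarith

/-- The splitting degenerates at `s = 0`, but then the equation integrates explicitly: `t³ z` is a
constant `c`, and `y + c/(2t²)` is constant. -/
theorem isBigO_one (h : IsScalarNAGD 0 t₀ y z) (ht₀ : 0 < t₀) :
    y =O[atTop] fun _ => (1 : ℝ) := by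
  have hofReal : ∀ t : ℝ, HasDerivAt (fun t : ℝ => (t : ℂ)) 1 t :=
    fun t => (hasDerivAt_id t).ofReal_comp
  have hz := eq_of_hasDerivWithinAt_Ici_zero (f := fun t => (t : ℂ) ^ 3 * z t) (a := t₀) fun t ht => by
    have htc : (t : ℂ) ≠ 0 := Complex.ofReal_ne_zero.2 (ht₀.trans_le ht).ne'
    refine (((hofReal t).pow 3).hasDerivWithinAt.mul (h t ht).2).congr_deriv ?_
    simp only [Pi.pow_apply]
    field_simp
    ring
  set c := (t₀ : ℂ) ^ 3 * z t₀
  have hy := eq_of_hasDerivWithinAt_Ici_zero (f := fun t => y t + c / (2 * (t : ℂ) ^ 2)) (a := t₀) fun t ht => by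
    have htc : (t : ℂ) ≠ 0 := Complex.ofReal_ne_zero.2 (ht₀.trans_le ht).ne'
    refine ((h t ht).1.add ((hasDerivAt_const t c).div (((hofReal t).pow 2).const_mul 2)
      (by simpa using htc)).hasDerivWithinAt).congr_deriv ?_
    simp only [Pi.pow_apply, ← hz t ht]
    field_simp
    ring
  set d := y t₀ + c / (2 * (t₀ : ℂ) ^ 2)
  refine IsBigO.of_bound (‖d‖ + ‖c‖ / (2 * t₀ ^ 2)) ?_
  filter_upwards [eventually_ge_atTop t₀] with t ht
  have : y t = d - c / (2 * (t : ℂ) ^ 2) := by rw [← hy t ht]; ring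
  rw [this, norm_one, mul_one]
  refine (norm_sub_le _ _).trans ?_
  gcongr
  simp only [norm_div, norm_mul, norm_pow, Complex.norm_ofNat, Complex.norm_real,
    Real.norm_eq_abs, sq_abs]
  gcongr

theorem eq_zero_of_initial (h : IsScalarNAGD μ t₀ y z) (ht₀ : 0 < t₀) (hs : s ^ 2 = -μ)
    (h0 : s ≠ 0) (hre : 0 ≤ s.re) (hy : y t₀ = 0) (hz : z t₀ = 0) {t : ℝ} (ht : t₀ ≤ t) :
    y t = 0 := by
  have h1 := (h.isSplitSystem ht₀ hs h0).eq_zero_of_initial ht₀ hre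
    (by simp [splitFactor, hy, hz]) (by simp [splitFactor, hy, hz]) ht
  have h2 := splitFactor_sub s y z t
  rw [h1.1, h1.2, sub_zero] at h2
  have h3 := liouvilleWeight_ne_zero (ht₀.trans_le ht)
  simpa [h0, h3] using h2.symm

/-- A solution is either recessive or grows exactly like `t^(-3/2) e^{(Re s) t}`. -/
theorem tendsto_zero_or_isTheta (h : IsScalarNAGD μ t₀ y z) (ht₀ : 0 < t₀) (hs : s ^ 2 = -μ)
    (hre : 0 < s.re) :
    (Tendsto (fun t => liouvilleWeight t * y t) atTop (𝓝 0) ∧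
      Tendsto (fun t => liouvilleWeight t * z t) atTop (𝓝 0)) ∨
    y =Θ[atTop] dampedExp s.re := by
  have h0 : s ≠ 0 := fun h => by simp [h] at hre
  rcases (h.isSplitSystem ht₀ hs h0).tendsto_zero_or_isTheta ht₀ hre with ⟨h1, h2⟩ | h1
  · left
    have h3 : Tendsto (fun t => liouvilleWeight t * y t) atTop (𝓝 0) := by
      have := (h1.sub h2).const_mul (2 * s)⁻¹
      rw [sub_zero, mul_zero] at this
      refine this.congr fun t => ?_
      rw [splitFactor_sub]
      field_simp
    refine ⟨h3, ?_⟩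
    -- The velocity is recovered from `P + M = 2 t^(3/2) z + (3/t) t^(3/2) y`; the flux argument
    -- needs its limit as well.
    have h4 : Tendsto (fun t : ℝ => 3 / (t : ℂ)) atTop (𝓝 0) := by
      have h5 : Tendsto (fun t : ℝ => ((3 / t : ℝ) : ℂ)) atTop (𝓝 ((0 : ℝ) : ℂ)) :=
        (Complex.continuous_ofReal.tendsto 0).comp (tendsto_const_nhds.div_atTop tendsto_id)
      simpa using h5
    have := ((h1.add h2).sub (h4.mul h3)).const_mul (2⁻¹ : ℂ)
    simp only [add_zero, mul_zero, sub_zero] at this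
    refine this.congr fun t => ?_
    rw [splitFactor_add]
    ring
  · right
    simp only [splitFactor_sub] at h1
    have hw : (fun t => (liouvilleWeight t)⁻¹) =Θ[atTop] fun t => ‖liouvilleWeight t‖⁻¹ := by
      simp only [← norm_inv]
      exact (isTheta_refl _ _).norm_right
    have h2 := hw.mul ((isTheta_const_mul_left (mul_ne_zero two_ne_zero h0)).1 h1)
    refine (EventuallyEq.trans_isTheta ?_ h2).trans_eventuallyEq ?_
    · filter_upwards [eventually_gt_atTop 0] with t ht
      rw [inv_mul_cancel_left₀ (liouvilleWeight_ne_zero ht)]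
    · filter_upwards [eventually_gt_atTop 0] with t ht
      rw [← liouvilleWeight_mul_dampedExp _ ht,
        inv_mul_cancel_left₀ (norm_ne_zero_iff.2 (liouvilleWeight_ne_zero ht))]

end IsScalarNAGD

/-! ### The solution regular at the origin -/

/-- The entire function `∑ xᵏ / (k! (k+n)!)`, a rescaled modified Bessel function of order `n`. -/
noncomputable def besselClifford (n : ℕ) (x : ℂ) : ℂ :=
  ∑' k : ℕ, x ^ k / ((k.factorial : ℂ) * ((k + n).factorial : ℂ))

theorem norm_div_factorial_mul_factorial_le (n k : ℕ) (x : ℂ) :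
    ‖x / ((k.factorial : ℂ) * ((k + n).factorial : ℂ))‖ ≤ ‖x‖ / (k.factorial : ℝ) := by
  rw [norm_div, norm_mul, Complex.norm_natCast, Complex.norm_natCast]
  have h1 : (0 : ℝ) < k.factorial := by exact_mod_cast k.factorial_pos
  have h2 : (1 : ℝ) ≤ (k + n).factorial := by exact_mod_cast (k + n).factorial_pos
  gcongr
  nlinarith

theorem summable_besselClifford (n : ℕ) (x : ℂ) :
    Summable fun k : ℕ => x ^ k / ((k.factorial : ℂ) * ((k + n).factorial : ℂ)) := by
  refine Summable.of_norm_bounded (Real.summable_pow_div_factorial ‖x‖) fun k => ?_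
  simpa using norm_div_factorial_mul_factorial_le n k (x ^ k)

theorem besselClifford_zero (n : ℕ) : besselClifford n 0 = 1 / (n.factorial : ℂ) := by
  rw [besselClifford, tsum_eq_single 0]
  · simp
  · intro k hk
    simp [hk]

/-- Termwise, `1/(k!(k+n)!) = (k+n+1)/(k!(k+n+1)!)`; the part `n+1` gives the first series and the
part `k`, after an index shift, the second. As each derivative raises the order by one, this is the
differential equation. -/
theorem besselClifford_eq (n : ℕ) (x : ℂ) :
    besselClifford n x = (n + 1) * besselClifford (n + 1) x + x * besselClifford (n + 2) x := by
  have h1 := summable_besselClifford n x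
  have h2 := (summable_besselClifford (n + 1) x).mul_left ((n : ℂ) + 1)
  have hterm : ∀ k : ℕ, x ^ k / ((k.factorial : ℂ) * ((k + n).factorial : ℂ)) -
      ((n : ℂ) + 1) * (x ^ k / ((k.factorial : ℂ) * ((k + (n + 1)).factorial : ℂ))) =
      k * (x ^ k / ((k.factorial : ℂ) * ((k + (n + 1)).factorial : ℂ))) := by
    intro k
    have e1 : (k.factorial : ℂ) ≠ 0 := by exact_mod_cast k.factorial_ne_zero
    have e2 : ((k + n).factorial : ℂ) ≠ 0 := by exact_mod_cast (k + n).factorial_ne_zero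
    have e3 : ((k : ℂ) + n + 1) ≠ 0 := by exact_mod_cast (k + n).succ_ne_zero
    rw [← add_assoc, Nat.factorial_succ]
    push_cast
    field_simp
    ring
  have h3 := h1.sub h2
  simp only [hterm] at h3
  have h4 : besselClifford n x - (n + 1) * besselClifford (n + 1) x =
      x * besselClifford (n + 2) x := by
    rw [besselClifford, besselClifford, ← tsum_mul_left, ← h1.tsum_sub h2]
    simp only [hterm]
    rw [h3.tsum_eq_zero_add, besselClifford, ← tsum_mul_left]
    simp only [Nat.cast_zero, zero_mul, zero_add]
    congr 1
    ext k
    have e1 : (k.factorial : ℂ) ≠ 0 := by exact_mod_cast k.factorial_ne_zero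
    have e2 : ((k + n + 2).factorial : ℂ) ≠ 0 := by exact_mod_cast (k + n + 2).factorial_ne_zero
    have e3 : ((k : ℂ) + 1) ≠ 0 := by exact_mod_cast k.succ_ne_zero
    rw [show k + 1 + (n + 1) = k + n + 2 by ring, show k + (n + 2) = k + n + 2 by ring,
      Nat.factorial_succ k]
    push_cast
    field_simp
    ring
  linear_combination h4

theorem hasDerivAt_besselClifford (n : ℕ) (x : ℂ) :
    HasDerivAt (besselClifford n) (besselClifford (n + 1) x) x := by
  -- Termwise differentiation on the ball of radius `‖x‖ + 1`: after an index shift this majorant is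
  -- an exponential series.
  have hsum : Summable fun k : ℕ => ((k : ℝ) * (‖x‖ + 1) ^ (k - 1)) / (k.factorial : ℝ) := by
    rw [← summable_nat_add_iff 1]
    refine (Real.summable_pow_div_factorial (‖x‖ + 1)).congr fun k => ?_
    have e1 : (k.factorial : ℝ) ≠ 0 := by exact_mod_cast k.factorial_ne_zero
    have e3 : ((k : ℝ) + 1) ≠ 0 := by exact_mod_cast k.succ_ne_zero
    rw [Nat.factorial_succ]
    push_cast
    field_simp
  have hbound : ∀ (k : ℕ) (w : ℂ), w ∈ Metric.ball (0 : ℂ) (‖x‖ + 1) →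
      ‖(k * w ^ (k - 1)) / ((k.factorial : ℂ) * ((k + n).factorial : ℂ))‖ ≤
        ((k : ℝ) * (‖x‖ + 1) ^ (k - 1)) / (k.factorial : ℝ) := by
    intro k w hw
    refine (norm_div_factorial_mul_factorial_le n k _).trans ?_
    rw [norm_mul, norm_pow, Complex.norm_natCast]
    rw [mem_ball_zero_iff] at hw
    gcongr
  have hx : x ∈ Metric.ball (0 : ℂ) (‖x‖ + 1) := by simp
  have h := hasDerivAt_tsum_of_isPreconnected hsum Metric.isOpen_ball
    (convex_ball (0 : ℂ) (‖x‖ + 1)).isPreconnected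
    (fun k w _ => (hasDerivAt_pow k w).div_const ((k.factorial : ℂ) * ((k + n).factorial : ℂ)))
    hbound hx (summable_besselClifford n x) hx
  refine h.congr_deriv ?_
  rw [(Summable.of_norm_bounded hsum fun k => hbound k x hx).tsum_eq_zero_add, besselClifford]
  simp only [Nat.cast_zero, zero_mul, zero_div, zero_add]
  congr 1
  ext k
  have e1 : (k.factorial : ℂ) ≠ 0 := by exact_mod_cast k.factorial_ne_zero
  have e2 : ((k + n + 1).factorial : ℂ) ≠ 0 := by exact_mod_cast (k + n + 1).factorial_ne_zero
  have e3 : ((k : ℂ) + 1) ≠ 0 := by exact_mod_cast k.succ_ne_zero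
  rw [show k + 1 + n = k + n + 1 by ring, ← add_assoc, Nat.factorial_succ k, Nat.add_sub_cancel]
  push_cast
  field_simp

/-- The solution of `y'' + (3/t) y' + μ y = 0` that is regular at `t = 0`. -/
noncomputable def regularSolution (μ : ℂ) (t : ℝ) : ℂ := besselClifford 1 (-μ / 4 * (t : ℂ) ^ 2)

/-- The derivative of `regularSolution`. -/
noncomputable def regularVelocity (μ : ℂ) (t : ℝ) : ℂ :=
  -μ / 2 * (t : ℂ) * besselClifford 2 (-μ / 4 * (t : ℂ) ^ 2)

theorem hasDerivAt_besselClifford_mul_sq (n : ℕ) (κ : ℂ) (t : ℝ) :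
    HasDerivAt (fun t : ℝ => besselClifford n (κ * (t : ℂ) ^ 2))
      (2 * κ * t * besselClifford (n + 1) (κ * (t : ℂ) ^ 2)) t := by
  have h1 : HasDerivAt (fun t : ℝ => (t : ℂ)) 1 t := (hasDerivAt_id t).ofReal_comp
  refine ((hasDerivAt_besselClifford n _).comp t ((h1.pow 2).const_mul κ)).congr_deriv ?_
  simp only [Pi.pow_apply]
  push_cast
  ring

theorem hasDerivAt_regularSolution (μ : ℂ) (t : ℝ) :
    HasDerivAt (regularSolution μ) (regularVelocity μ t) t := by
  refine (hasDerivAt_besselClifford_mul_sq 1 (-μ / 4) t).congr_deriv ?_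
  rw [regularVelocity]
  ring

theorem hasDerivAt_regularVelocity (μ : ℂ) {t : ℝ} (ht : t ≠ 0) :
    HasDerivAt (regularVelocity μ)
      (-(3 / (t : ℂ) * regularVelocity μ t) - μ * regularSolution μ t) t := by
  have h1 : HasDerivAt (fun t : ℝ => (t : ℂ)) 1 t := (hasDerivAt_id t).ofReal_comp
  have htc : (t : ℂ) ≠ 0 := Complex.ofReal_ne_zero.2 ht
  refine ((h1.const_mul (-μ / 2)).mul
    (hasDerivAt_besselClifford_mul_sq 2 (-μ / 4) t)).congr_deriv ?_
  have h2 := besselClifford_eq 1 (-μ / 4 * (t : ℂ) ^ 2)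
  rw [regularVelocity, regularSolution, h2]
  push_cast
  field_simp
  ring

theorem regularSolution_zero (μ : ℂ) : regularSolution μ 0 = 1 := by
  simp [regularSolution, besselClifford_zero]

theorem continuous_regularSolution (μ : ℂ) : Continuous (regularSolution μ) :=
  continuous_iff_continuousAt.2 fun t => (hasDerivAt_regularSolution μ t).continuousAt

theorem continuous_regularVelocity (μ : ℂ) : Continuous (regularVelocity μ) :=
  (continuous_const.mul Complex.continuous_ofReal).mul (continuous_iff_continuousAt.2 fun t =>
    (hasDerivAt_besselClifford_mul_sq 2 (-μ / 4) t).continuousAt)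

theorem isScalarNAGD_regularSolution (μ : ℂ) {t₀ : ℝ} (ht₀ : 0 < t₀) :
    IsScalarNAGD μ t₀ (regularSolution μ) (regularVelocity μ) := fun t ht =>
  ⟨(hasDerivAt_regularSolution μ t).hasDerivWithinAt,
    (hasDerivAt_regularVelocity μ (ht₀.trans_le ht).ne').hasDerivWithinAt⟩

/-- The flux `t³ Im(y' ȳ)` of the regular solution has derivative `-(Im μ) t³ |y|²`. -/
theorem hasDerivAt_flux (μ : ℂ) {t : ℝ} (ht : t ≠ 0) :
    HasDerivAt (fun t : ℝ => ((t : ℂ) ^ 3 * regularVelocity μ t *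
        (starRingEnd ℂ) (regularSolution μ t)).im)
      (-μ.im * (t ^ 3 * ‖regularSolution μ t‖ ^ 2)) t := by
  have h1 : HasDerivAt (fun t : ℝ => (t : ℂ)) 1 t := (hasDerivAt_id t).ofReal_comp
  have htc : (t : ℂ) ≠ 0 := Complex.ofReal_ne_zero.2 ht
  have h2 := (((h1.pow 3).mul (hasDerivAt_regularVelocity μ ht)).mul
    (hasDerivAt_regularSolution μ t).star)
  have h3 := Complex.imCLM.hasFDerivAt.comp_hasDerivAt t h2
  refine h3.congr_deriv ?_
  rw [Complex.imCLM_apply, ← Complex.normSq_eq_norm_sq, Complex.normSq_apply]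
  have h4 : ((t : ℂ) ^ 3).im = 0 := by rw [← Complex.ofReal_pow, Complex.ofReal_im]
  have h5 : ((t : ℂ) ^ 3).re = t ^ 3 := by rw [← Complex.ofReal_pow, Complex.ofReal_re]
  set y := regularSolution μ t
  set z := regularVelocity μ t
  have h6 : ((3 : ℕ) * (t : ℂ) ^ (3 - 1) * 1 * z + (t : ℂ) ^ 3 * (-(3 / (t : ℂ) * z) - μ * y)) =
      -((t : ℂ) ^ 3 * (μ * y)) := by
    field_simp
    push_cast
    ring
  simp only [Pi.pow_apply, Pi.mul_apply] at h6 ⊢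
  rw [h6]
  simp only [Complex.star_def, Complex.add_im, Complex.mul_im, Complex.neg_im, Complex.neg_re,
    Complex.mul_re, Complex.conj_re, Complex.conj_im, h4, h5]
  ring

/-- A recessive solution has flux tending to `0`; the flux of the regular solution also vanishes at
`t = 0`. Monotonicity then makes it vanish identically, and with it `|y|²`. -/
theorem not_tendsto_zero_regularSolution {μ : ℂ} (hμ : μ.im ≠ 0) :
    ¬ (Tendsto (fun t => liouvilleWeight t * regularSolution μ t) atTop (𝓝 0) ∧
      Tendsto (fun t => liouvilleWeight t * regularVelocity μ t) atTop (𝓝 0)) := by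
  rintro ⟨hy, hz⟩
  -- The factor `-Im μ` makes the derivative `(Im μ)² t³ |y|²`, nonnegative whatever the sign of `Im
  -- μ`.
  set W : ℝ → ℝ := fun t => -μ.im * ((t : ℂ) ^ 3 * regularVelocity μ t *
        (starRingEnd ℂ) (regularSolution μ t)).im with hW
  have hder : ∀ t, t ≠ 0 → HasDerivAt W
      (μ.im ^ 2 * (t ^ 3 * ‖regularSolution μ t‖ ^ 2)) t := fun t ht =>
    ((hasDerivAt_flux μ ht).const_mul (-μ.im)).congr_deriv (by ring)
  have hcont : Continuous W := by
    refine continuous_const.mul (Complex.continuous_im.comp ?_)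
    exact ((Complex.continuous_ofReal.pow 3).mul (continuous_regularVelocity μ)).mul
      (Complex.continuous_conj.comp (continuous_regularSolution μ))
  have hmono : MonotoneOn W (Set.Ici 0) := by
    refine monotoneOn_of_hasDerivWithinAt_nonneg (convex_Ici 0) hcont.continuousOn
      (f' := fun t => μ.im ^ 2 * (t ^ 3 * ‖regularSolution μ t‖ ^ 2)) (fun t ht => ?_)
      (fun t ht => ?_)
    · rw [interior_Ici] at ht
      exact (hder t ht.ne').hasDerivWithinAt
    · rw [interior_Ici] at ht
      have : 0 < t := ht
      positivity
  have hlim : Tendsto W atTop (𝓝 0) := by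
    have h1 := (Complex.continuous_im.tendsto _).comp
      (hz.mul ((Complex.continuous_conj.tendsto _).comp hy))
    have h2 := h1.const_mul (-μ.im)
    simp only [map_zero, mul_zero, Complex.zero_im] at h2
    refine h2.congr' ?_
    filter_upwards [eventually_gt_atTop 0] with t ht
    -- The two weights `t^(3/2)` multiply to the `t³` of the flux.
    have h3 : liouvilleWeight t * (starRingEnd ℂ) (liouvilleWeight t) = (t : ℂ) ^ 3 := by
      rw [liouvilleWeight, Complex.conj_ofReal, ← Complex.ofReal_mul, ← Real.rpow_add ht]
      norm_num
    simp only [hW, Function.comp, map_mul, ← h3]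
    congr 2
    ring
  have hzero : ∀ t, 0 ≤ t → W t = 0 := by
    intro t ht
    have h0 : W 0 = 0 := by simp [hW]
    refine le_antisymm (ge_of_tendsto hlim ?_) (h0 ▸ hmono Set.self_mem_Ici ht ht)
    filter_upwards [eventually_ge_atTop t] with t' ht'
    exact hmono ht (ht.trans ht') ht'
  have hy0 : ∀ t, 0 < t → regularSolution μ t = 0 := by
    intro t ht
    have h1 : HasDerivAt W 0 t := by
      refine (hasDerivAt_const t (0 : ℝ)).congr_of_eventuallyEq ?_
      filter_upwards [eventually_gt_nhds ht] with t' ht' using hzero t' ht'.le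
    have h2 := (hder t ht.ne').unique h1
    have h3 : t ^ 3 ≠ 0 := (pow_pos ht 3).ne'
    simpa [hμ, ht.ne'] using h2
  have h1 : Tendsto (regularSolution μ) (𝓝[>] 0) (𝓝 (regularSolution μ 0)) :=
    ((continuous_regularSolution μ).tendsto 0).mono_left nhdsWithin_le_nhds
  have h2 : Tendsto (regularSolution μ) (𝓝[>] 0) (𝓝 0) :=
    tendsto_const_nhds.congr' (eventually_mem_nhdsWithin.mono fun t ht => (hy0 t ht).symm)
  have := tendsto_nhds_unique h1 h2
  rw [regularSolution_zero] at this
  exact one_ne_zero this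

theorem regularSolution_isTheta {μ s : ℂ} (hμ : μ.im ≠ 0) (hs : s ^ 2 = -μ) (hre : 0 < s.re) :
    regularSolution μ =Θ[atTop] dampedExp s.re :=
  ((isScalarNAGD_regularSolution μ one_pos).tendsto_zero_or_isTheta one_pos hs hre).resolve_left
    (not_tendsto_zero_regularSolution hμ)

/-! ### Recessive initial data -/

/-- Initial data at time `t₀` of the recessive solutions of the scalar equation. -/
noncomputable def recessiveSubspace (μ : ℂ) (t₀ : ℝ) : Submodule ℂ (ℂ × ℂ) where
  carrier := {p | ∃ y z : ℝ → ℂ, IsScalarNAGD μ t₀ y z ∧ (y t₀, z t₀) = p ∧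
    Tendsto (fun t => liouvilleWeight t * y t) atTop (𝓝 0) ∧
    Tendsto (fun t => liouvilleWeight t * z t) atTop (𝓝 0)}
  add_mem' := by
    rintro _ _ ⟨y, z, h, rfl, hy, hz⟩ ⟨y', z', h', rfl, hy', hz'⟩
    refine ⟨_, _, h.add h', rfl, ?_, ?_⟩
    · simpa [mul_add] using hy.add hy'
    · simpa [mul_add] using hz.add hz'
  zero_mem' := ⟨fun _ => 0, fun _ => 0, fun t _ =>
    ⟨hasDerivWithinAt_const _ _ _, (hasDerivWithinAt_const _ _ _).congr_deriv (by simp)⟩,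
    rfl, by simp, by simp⟩
  smul_mem' := by
    rintro c _ ⟨y, z, h, rfl, hy, hz⟩
    refine ⟨_, _, h.const_mul c, rfl, ?_, ?_⟩
    · simpa [mul_left_comm] using hy.const_mul c
    · simpa [mul_left_comm] using hz.const_mul c

theorem IsScalarNAGD.isTheta_of_notMem {μ s : ℂ} {t₀ : ℝ} {y z : ℝ → ℂ}
    (h : IsScalarNAGD μ t₀ y z) (ht₀ : 0 < t₀) (hs : s ^ 2 = -μ) (hre : 0 < s.re)
    (hmem : (y t₀, z t₀) ∉ recessiveSubspace μ t₀) : y =Θ[atTop] dampedExp s.re :=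
  (h.tendsto_zero_or_isTheta ht₀ hs hre).resolve_left fun hlim => hmem ⟨y, z, h, rfl, hlim⟩

/-- If all data were recessive, forward uniqueness would identify the regular solution with a
recessive one on `[t₀, ∞)`. -/
theorem recessiveSubspace_ne_top {μ s : ℂ} {t₀ : ℝ} (ht₀ : 0 < t₀) (hμ : μ.im ≠ 0)
    (hs : s ^ 2 = -μ) (hre : 0 < s.re) : recessiveSubspace μ t₀ ≠ ⊤ := by
  intro htop
  have hmem : (regularSolution μ t₀, regularVelocity μ t₀) ∈ recessiveSubspace μ t₀ :=
    htop ▸ Submodule.mem_top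
  obtain ⟨y, z, h, heq, hlim⟩ := hmem
  obtain ⟨hy0, hz0⟩ := Prod.ext_iff.1 heq
  simp only at hy0 hz0
  have hreg := isScalarNAGD_regularSolution μ ht₀
  have h0 : s ≠ 0 := fun h => by simp [h] at hre
  have hdiff := hreg.add (h.const_mul (-1))
  have hy : ∀ t, t₀ ≤ t → regularSolution μ t = y t := fun t ht => by
    have := hdiff.eq_zero_of_initial ht₀ hs h0 hre.le (by simp [hy0]) (by simp [hz0]) ht
    linear_combination this
  have hz : ∀ t, t₀ ≤ t → regularVelocity μ t = z t := fun t ht => by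
    refine (uniqueDiffOn_Ici t₀ t ht).eq_deriv _ (hreg t ht).1 ?_
    exact (h t ht).1.congr hy (hy t ht)
  refine not_tendsto_zero_regularSolution hμ ⟨hlim.1.congr' ?_, hlim.2.congr' ?_⟩
  · filter_upwards [eventually_ge_atTop t₀] with t ht
    rw [hy t ht]
  · filter_upwards [eventually_ge_atTop t₀] with t ht
    rw [hz t ht]

/-! ### The growth rate `|Im √μ|` -/

/-- `imSqrt μ` is the nonnegative real part of a square root of `-μ`. -/
theorem exists_sq_eq_neg_re_eq_imSqrt (μ : ℂ) : ∃ s : ℂ, s ^ 2 = -μ ∧ s.re = imSqrt μ := by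
  have h : (μ ^ (1 / 2 : ℂ)) ^ 2 = μ := by
    rw [one_div]
    exact Complex.cpow_ofNat_inv_pow μ 2
  rcases abs_choice (μ ^ (1 / 2 : ℂ)).im with h1 | h1
  · refine ⟨-(Complex.I * μ ^ (1 / 2 : ℂ)), ?_, ?_⟩
    · rw [neg_sq, mul_pow, h, Complex.I_sq, neg_one_mul]
    · rw [imSqrt, h1]
      simp
  · refine ⟨Complex.I * μ ^ (1 / 2 : ℂ), ?_, ?_⟩
    · rw [mul_pow, h, Complex.I_sq, neg_one_mul]
    · rw [imSqrt, h1]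
      simp

theorem imSqrt_eq_sqrt (a b : ℝ) :
    imSqrt ((a : ℂ) + (b : ℂ) * Complex.I) = √((√(a ^ 2 + b ^ 2) - a) / 2) := by
  set μ : ℂ := (a : ℂ) + (b : ℂ) * Complex.I with hμ
  have h : (μ ^ (1 / 2 : ℂ)) ^ 2 = μ := by
    rw [one_div]
    exact Complex.cpow_ofNat_inv_pow μ 2
  rw [imSqrt]
  set r := μ ^ (1 / 2 : ℂ)
  -- Real part and modulus of `r² = μ`; half the difference of the two identities is `(Im r)²`.
  have h1 : r.re ^ 2 - r.im ^ 2 = a := by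
    have := congrArg Complex.re h
    simp [hμ, sq] at this
    linarith
  have h2 : r.re ^ 2 + r.im ^ 2 = √(a ^ 2 + b ^ 2) := by
    have := congrArg norm h
    rw [norm_pow, ← Complex.normSq_eq_norm_sq, Complex.normSq_apply, hμ,
      Complex.norm_add_mul_I] at this
    rw [← this]
    ring
  rw [← h2, ← h1, ← Real.sqrt_sq_eq_abs]
  congr 1
  ring

theorem imSqrt_pos (a : ℝ) {b : ℝ} (hb : b ≠ 0) :
    0 < imSqrt ((a : ℂ) + (b : ℂ) * Complex.I) := by
  rw [imSqrt_eq_sqrt]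
  have h : a < √(a ^ 2 + b ^ 2) := by
    refine Real.lt_sqrt_of_sq_lt ?_
    have : 0 < b ^ 2 := by positivity
    linarith
  exact Real.sqrt_pos.2 (by linarith)

/-! ### Eigenvectors of normal matrices -/

section Spectral

variable {N : ℕ} {G : Matrix (Fin N) (Fin N) ℝ}

open scoped ComplexOrder in
theorem Matrix.conjTranspose_mulVec_eq_zero_of_normal {A : Matrix (Fin N) (Fin N) ℂ}
    (hA : Aᴴ * A = A * Aᴴ) {u : Fin N → ℂ} : Aᴴ *ᵥ u = 0 ↔ A *ᵥ u = 0 := by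
  rw [← Matrix.self_mul_conjTranspose_mulVec_eq_zero, ← hA,
    Matrix.conjTranspose_mul_self_mulVec_eq_zero]

open scoped ComplexOrder in
-- If `A(Au) = 0`, then `Aᴴ(Au) = 0` because `A` and `Aᴴ` have the same kernel, hence `Au = 0`.
-- Applied to `G - μ`, generalized eigenvectors are eigenvectors.
theorem Matrix.mulVec_eq_zero_of_pow_of_normal {A : Matrix (Fin N) (Fin N) ℂ}
    (hA : Aᴴ * A = A * Aᴴ) (k : ℕ) {u : Fin N → ℂ} (h : (A ^ (k + 1)) *ᵥ u = 0) :
    A *ᵥ u = 0 := by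
  induction k generalizing u with
  | zero => simpa using h
  | succ k ih =>
    rw [pow_succ, ← Matrix.mulVec_mulVec] at h
    have h1 := (Matrix.conjTranspose_mulVec_eq_zero_of_normal hA).2 (ih h)
    rwa [Matrix.mulVec_mulVec, Matrix.conjTranspose_mul_self_mulVec_eq_zero] at h1

theorem conjTranspose_map_ofReal (G : Matrix (Fin N) (Fin N) ℝ) :
    (G.map (fun r : ℝ => (r : ℂ)))ᴴ = Gᵀ.map (fun r : ℝ => (r : ℂ)) := by
  ext i j
  simp [Matrix.conjTranspose_apply]

theorem normal_map_ofReal_sub_smul (hG : G * Gᵀ = Gᵀ * G) (μ : ℂ) :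
    (G.map (fun r : ℝ => (r : ℂ)) - μ • 1)ᴴ * (G.map (fun r : ℝ => (r : ℂ)) - μ • 1) =
      (G.map (fun r : ℝ => (r : ℂ)) - μ • 1) * (G.map (fun r : ℝ => (r : ℂ)) - μ • 1)ᴴ := by
  have h := congrArg (fun A : Matrix (Fin N) (Fin N) ℝ => A.map Complex.ofRealHom) hG
  simp only [Matrix.map_mul] at h
  have h' : G.map (fun r : ℝ => (r : ℂ)) * Gᵀ.map (fun r : ℝ => (r : ℂ)) =
    Gᵀ.map (fun r : ℝ => (r : ℂ)) * G.map (fun r : ℝ => (r : ℂ)) := h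
  rw [Matrix.conjTranspose_sub, conjTranspose_map_ofReal, Matrix.conjTranspose_smul,
    Matrix.conjTranspose_one]
  simp only [sub_mul, mul_sub, Matrix.smul_mul, Matrix.mul_smul, one_mul, mul_one, h',
    smul_smul, mul_comm μ]
  abel

theorem mulVec_eq_smul_iff (A : Matrix (Fin N) (Fin N) ℂ) (μ : ℂ) (u : Fin N → ℂ) :
    A *ᵥ u = μ • u ↔ (A - μ • 1) *ᵥ u = 0 := by
  rw [Matrix.sub_mulVec, Matrix.smul_mulVec, Matrix.one_mulVec, sub_eq_zero]

theorem star_vecMul_eq_smul_iff (A : Matrix (Fin N) (Fin N) ℂ) (μ : ℂ) (u : Fin N → ℂ) :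
    star u ᵥ* A = μ • star u ↔ (A - μ • 1)ᴴ *ᵥ u = 0 := by
  rw [← star_inj, Matrix.star_vecMul, star_star, star_smul, star_star, Matrix.conjTranspose_sub,
    Matrix.conjTranspose_smul, Matrix.conjTranspose_one, mulVec_eq_smul_iff]

/-- For normal `G`, left eigenvectors and right eigenvectors coincide. -/
theorem isLeftEigenvector_iff (hG : G * Gᵀ = Gᵀ * G) (μ : ℂ) (u : Fin N → ℂ) :
    IsLeftEigenvector G μ u ↔ u ≠ 0 ∧ G.map (fun r : ℝ => (r : ℂ)) *ᵥ u = μ • u := by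
  rw [IsLeftEigenvector, star_vecMul_eq_smul_iff, mulVec_eq_smul_iff,
    Matrix.conjTranspose_mulVec_eq_zero_of_normal (normal_map_ofReal_sub_smul hG μ)]

theorem isComplexEigenvalue_iff (μ : ℂ) :
    IsComplexEigenvalue G μ ↔
      ∃ u : Fin N → ℂ, u ≠ 0 ∧ G.map (fun r : ℝ => (r : ℂ)) *ᵥ u = μ • u := by
  constructor
  · intro h
    obtain ⟨u, hu⟩ := h.exists_hasEigenvector
    exact ⟨u, hu.2, by simpa using hu.apply_eq_smul⟩
  · rintro ⟨u, h0, hu⟩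
    exact Module.End.hasEigenvalue_of_hasEigenvector (x := u)
      ⟨Module.End.mem_eigenspace_iff.2 (by simpa using hu), h0⟩

/-- A complex property of vectors that is linear and holds for the left eigenvectors of a normal
matrix holds for all vectors. -/
theorem induction_on_leftEigenvectors (hG : G * Gᵀ = Gᵀ * G) {p : (Fin N → ℂ) → Prop}
    (zero : p 0) (add : ∀ w w', p w → p w' → p (w + w'))
    (eigen : ∀ μ w, IsComplexEigenvalue G μ → IsLeftEigenvector G μ w → p w)
    (w : Fin N → ℂ) : p w := by
  have hw : w ∈ ⨆ μ : ℂ, Module.End.maxGenEigenspace (Matrix.toLin' (G.map (fun r : ℝ => (r : ℂ)))) μ := by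
    rw [Module.End.iSup_maxGenEigenspace_eq_top]
    exact Submodule.mem_top
  refine Submodule.iSup_induction _ (motive := p) hw (fun μ u hu => ?_) zero add
  obtain ⟨k, hk⟩ := (Module.End.mem_maxGenEigenspace _ _ _).1 hu
  by_cases h0 : u = 0
  · exact h0 ▸ zero
  have h1 : Matrix.toLin' (G.map (fun r : ℝ => (r : ℂ))) - μ • 1 =
      Matrix.toLin' (G.map (fun r : ℝ => (r : ℂ)) - μ • 1) := by
    ext
    simp
  rw [h1, ← Matrix.toLin'_pow, Matrix.toLin'_apply] at hk
  -- The exponent `k` may be `0`, so one more factor is applied to reach `k + 1`.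
  have h2 := Matrix.mulVec_eq_zero_of_pow_of_normal (normal_map_ofReal_sub_smul hG μ) k
    (u := u) (by rw [pow_succ', ← Matrix.mulVec_mulVec, hk, Matrix.mulVec_zero])
  have h3 : u ≠ 0 ∧ G.map (fun r : ℝ => (r : ℂ)) *ᵥ u = μ • u :=
    ⟨h0, (mulVec_eq_smul_iff _ _ _).2 h2⟩
  exact eigen μ u ((isComplexEigenvalue_iff μ).2 ⟨u, h3⟩) ((isLeftEigenvector_iff hG μ u).2 h3)

end Spectral

/-! ### Modal components -/

section Modal

variable {N : ℕ} {G : Matrix (Fin N) (Fin N) ℝ}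

/-- `modal w` as a continuous real-linear map. -/
noncomputable def modalCLM (w : Fin N → ℂ) : EuclideanSpace ℝ (Fin N) →L[ℝ] ℂ :=
  LinearMap.toContinuousLinearMap
    { toFun := modal w
      map_add' := fun x y => by
        simp [modal, dotProduct, mul_add, Finset.sum_add_distrib]
      map_smul' := fun c x => by
        simp [modal, dotProduct, Finset.mul_sum, mul_left_comm] }

@[simp]
theorem modalCLM_apply (w : Fin N → ℂ) (x : EuclideanSpace ℝ (Fin N)) :
    modalCLM w x = modal w x := rfl

theorem modal_zero_left (x : EuclideanSpace ℝ (Fin N)) : modal 0 x = 0 := by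
  simp [modal]

theorem modal_add_left (w w' : Fin N → ℂ) (x : EuclideanSpace ℝ (Fin N)) :
    modal (w + w') x = modal w x + modal w' x := by
  simp [modal]

theorem modal_neg (w : Fin N → ℂ) (x : EuclideanSpace ℝ (Fin N)) :
    modal w (-x) = -modal w x := map_neg (modalCLM w) x

theorem modal_single_left (i : Fin N) (x : EuclideanSpace ℝ (Fin N)) :
    modal (Pi.single i 1) x = x i := by
  simp [modal]

theorem exists_modal_ne_zero {w : Fin N → ℂ} (hw : w ≠ 0) :
    ∃ x : EuclideanSpace ℝ (Fin N), modal w x ≠ 0 := by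
  obtain ⟨i, hi⟩ := Function.ne_iff.1 hw
  refine ⟨EuclideanSpace.single i 1, ?_⟩
  have : (fun j => ((EuclideanSpace.single i (1 : ℝ) : EuclideanSpace ℝ (Fin N)) j : ℂ)) =
      Pi.single i 1 := by
    ext j
    by_cases h : j = i <;> simp [h]
  rw [modal, this, dotProduct_single]
  simpa using hi

/-- Coordinates are the components along `Pi.single i 1`, so estimates of `modal w` for every `w`
control the norm. -/
theorem norm_le_sum_modal (x : EuclideanSpace ℝ (Fin N)) :
    ‖x‖ ≤ ∑ i, ‖modal (Pi.single i 1) x‖ := by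
  conv_lhs => rw [← (EuclideanSpace.basisFun (Fin N) ℝ).sum_repr x]
  refine (norm_sum_le _ _).trans (Finset.sum_le_sum fun i _ => ?_)
  simp [modal_single_left, norm_smul]

theorem IsLeftEigenvector.modal_mulVec {μ : ℂ} {w : Fin N → ℂ} (h : IsLeftEigenvector G μ w)
    (x : EuclideanSpace ℝ (Fin N)) :
    modal w (WithLp.toLp 2 (G *ᵥ x.ofLp)) = μ * modal w x := by
  have h1 : (fun i => (((WithLp.toLp 2 (G *ᵥ x.ofLp) : EuclideanSpace ℝ (Fin N)) i : ℝ) : ℂ)) =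
      G.map (fun r : ℝ => (r : ℂ)) *ᵥ fun i => (x i : ℂ) := by
    ext i
    simp [Matrix.mulVec, dotProduct]
  rw [modal, h1, Matrix.dotProduct_mulVec, h.2, smul_dotProduct, smul_eq_mul, modal]

theorem HasDerivWithinAt.modal {x : ℝ → EuclideanSpace ℝ (Fin N)}
    {x' : EuclideanSpace ℝ (Fin N)} {S : Set ℝ} {t : ℝ} (h : HasDerivWithinAt x x' S t)
    (w : Fin N → ℂ) : HasDerivWithinAt (fun t => modal w (x t)) (modal w x') S t :=
  (modalCLM w).hasFDerivAt.comp_hasDerivWithinAt t h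

/-- The modal component of a solution solves the scalar equation. -/
theorem IsNAGD.isScalarNAGD_modal {t₀ : ℝ} {q v : ℝ → EuclideanSpace ℝ (Fin N)}
    (h : IsNAGD G t₀ q v) {μ : ℂ} {w : Fin N → ℂ} (hw : IsLeftEigenvector G μ w) :
    IsScalarNAGD μ t₀ (fun t => modal w (q t)) (fun t => modal w (v t)) := fun t ht => by
  refine ⟨(h t ht).1.modal w, ((h t ht).2.modal w).congr_deriv ?_⟩
  rw [← modalCLM_apply, map_sub, map_neg, map_smul, modalCLM_apply, modalCLM_apply,
    hw.modal_mulVec]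
  simp

theorem IsGradientPlay.modal_eq {x : ℝ → EuclideanSpace ℝ (Fin N)} (h : IsGradientPlay G x)
    {μ : ℂ} {w : Fin N → ℂ} (hw : IsLeftEigenvector G μ w) {t : ℝ} (ht : 0 ≤ t) :
    modal w (x t) = Complex.exp (-μ * t) * modal w (x 0) := by
  have h1 := eq_of_hasDerivWithinAt_Ici_zero (a := 0)
    (f := fun t : ℝ => Complex.exp (μ * t) * modal w (x t)) (fun t ht => by
      have h2 : HasDerivAt (fun t : ℝ => Complex.exp (μ * t)) (Complex.exp (μ * t) * μ) t := by
        have h3 : HasDerivAt (fun t : ℝ => (t : ℂ)) 1 t := (hasDerivAt_id t).ofReal_comp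
        simpa using (h3.const_mul μ).cexp
      refine (h2.hasDerivWithinAt.mul ((h t ht).modal w)).congr_deriv ?_
      rw [modal_neg, hw.modal_mulVec]
      ring) t ht
  simp only [Complex.ofReal_zero, mul_zero, Complex.exp_zero, one_mul] at h1
  rw [← h1, ← mul_assoc, ← Complex.exp_add]
  simp

theorem IsGradientPlay.norm_modal_eq {x : ℝ → EuclideanSpace ℝ (Fin N)} (h : IsGradientPlay G x)
    {μ : ℂ} {w : Fin N → ℂ} (hw : IsLeftEigenvector G μ w) {t : ℝ} (ht : 0 ≤ t) :
    ‖modal w (x t)‖ = Real.exp (-μ.re * t) * ‖modal w (x 0)‖ := by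
  rw [h.modal_eq hw ht, norm_mul, Complex.norm_exp]
  simp

end Modal

/-! ### Decay rate of gradient play -/

section GradientPlay

variable {N : ℕ} {G : Matrix (Fin N) (Fin N) ℝ}

theorem exists_hasDerivAt_clm_apply {E : Type*} [NormedAddCommGroup E] [NormedSpace ℝ E]
    [CompleteSpace E] (A : E →L[ℝ] E) (x₀ : E) :
    ∃ x : ℝ → E, (∀ t, HasDerivAt x (A (x t)) t) ∧ x 0 = x₀ := by
  refine ⟨fun t => (NormedSpace.exp (t • A) : E →L[ℝ] E) x₀, fun t => ?_, ?_⟩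
  · refine ((hasDerivAt_exp_smul_const' A t).clm_apply (hasDerivAt_const t x₀)).congr_deriv ?_
    simp
  · simp

theorem exists_isGradientPlay (G : Matrix (Fin N) (Fin N) ℝ) (x₀ : EuclideanSpace ℝ (Fin N)) :
    ∃ x : ℝ → EuclideanSpace ℝ (Fin N), IsGradientPlay G x ∧ x 0 = x₀ := by
  obtain ⟨x, hx, h0⟩ := exists_hasDerivAt_clm_apply
    (-LinearMap.toContinuousLinearMap (Matrix.toEuclideanLin G)) x₀
  refine ⟨x, fun t _ => (hx t).hasDerivWithinAt.congr_deriv ?_, h0⟩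
  simp [Matrix.toLpLin_apply]

/-- A solution with nonzero component along an eigenvector decays no faster than that mode. -/
theorem le_re_of_gradientPlayExpStable (hG : G * Gᵀ = Gᵀ * G) {r : ℝ}
    (h : GradientPlayExpStable G r) {μ : ℂ} (hμ : IsComplexEigenvalue G μ) : r ≤ μ.re := by
  obtain ⟨w, hw⟩ := (isComplexEigenvalue_iff μ).1 hμ
  have hl := (isLeftEigenvector_iff hG μ w).2 hw
  obtain ⟨x₀, hx₀⟩ := exists_modal_ne_zero hw.1
  obtain ⟨x, hx, rfl⟩ := exists_isGradientPlay G x₀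
  obtain ⟨-, C, hC, hb⟩ := h
  by_contra! hlt
  have hbound : ∀ t : ℝ, 0 ≤ t → Real.exp ((r - μ.re) * t) * ‖modal w (x 0)‖ ≤
      ‖modalCLM w‖ * (C * ‖x 0‖) := by
    intro t ht
    have h1 := (modalCLM w).le_opNorm (x t)
    rw [modalCLM_apply, hx.norm_modal_eq hl ht] at h1
    have h2 := h1.trans (mul_le_mul_of_nonneg_left (hb x hx t ht) (norm_nonneg _))
    have h3 : Real.exp ((r - μ.re) * t) = Real.exp (r * t) * Real.exp (-μ.re * t) := by
      rw [← Real.exp_add]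
      ring_nf
    have h4 : Real.exp (r * t) * Real.exp (-r * t) = 1 := by
      rw [← Real.exp_add]
      simp
    calc _ = Real.exp (r * t) * (Real.exp (-μ.re * t) * ‖modal w (x 0)‖) := by rw [h3]; ring
      _ ≤ Real.exp (r * t) * (‖modalCLM w‖ * (C * Real.exp (-r * t) * ‖x 0‖)) := by gcongr
      _ = (Real.exp (r * t) * Real.exp (-r * t)) * (‖modalCLM w‖ * (C * ‖x 0‖)) := by ring
      _ = _ := by rw [h4, one_mul]
  have hlim : Tendsto (fun t : ℝ => Real.exp ((r - μ.re) * t) * ‖modal w (x 0)‖) atTop atTop :=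
    (Real.tendsto_exp_atTop.comp (tendsto_id.const_mul_atTop (sub_pos.2 hlt))).atTop_mul_const
      (norm_pos_iff.2 hx₀)
  obtain ⟨t, h1, h2⟩ := ((hlim.eventually_gt_atTop (‖modalCLM w‖ * (C * ‖x 0‖))).and
    (eventually_ge_atTop 0)).exists
  exact absurd (hbound t h2) (not_le.2 h1)

theorem gradientPlayExpStable_of_le_re (hG : G * Gᵀ = Gᵀ * G) {r : ℝ} (hr : 0 < r)
    (h : ∀ μ : ℂ, IsComplexEigenvalue G μ → r ≤ μ.re) : GradientPlayExpStable G r := by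
  -- The constant is chosen before the solution, as uniform stability demands.
  have key : ∀ w : Fin N → ℂ, ∃ C : ℝ, 0 ≤ C ∧ ∀ x : ℝ → EuclideanSpace ℝ (Fin N),
      IsGradientPlay G x → ∀ t : ℝ, 0 ≤ t →
        ‖modal w (x t)‖ ≤ C * (Real.exp (-r * t) * ‖x 0‖) := by
    refine induction_on_leftEigenvectors hG ⟨0, le_rfl, fun x _ t _ => by simp [modal_zero_left]⟩
      ?_ ?_
    · rintro w w' ⟨C, hC, hb⟩ ⟨C', hC', hb'⟩
      refine ⟨C + C', add_nonneg hC hC', fun x hx t ht => ?_⟩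
      rw [modal_add_left, add_mul]
      exact (norm_add_le _ _).trans (add_le_add (hb x hx t ht) (hb' x hx t ht))
    · intro μ w hμ hw
      refine ⟨‖modalCLM w‖, norm_nonneg _, fun x hx t ht => ?_⟩
      rw [hx.norm_modal_eq hw ht, mul_left_comm]
      have h1 := (modalCLM w).le_opNorm (x 0)
      rw [modalCLM_apply] at h1
      have h2 := h μ hμ
      gcongr
  choose C hC hb using key
  refine ⟨hr, 1 + ∑ i, C (Pi.single i 1), by
    have := Finset.sum_nonneg fun (i : Fin N) (_ : i ∈ Finset.univ) => hC (Pi.single i 1)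
    linarith, fun x hx t ht => ?_⟩
  refine (norm_le_sum_modal (x t)).trans ?_
  refine (Finset.sum_le_sum fun i _ => hb (Pi.single i 1) x hx t ht).trans ?_
  rw [← Finset.sum_mul, mul_assoc]
  gcongr
  linarith

theorem gradientPlayDecayRate_iff (hG : G * Gᵀ = Gᵀ * G) {μ₀ : ℂ}
    (hμ₀ : IsComplexEigenvalue G μ₀) (hpos : 0 < μ₀.re) :
    GradientPlayDecayRate G μ₀.re ↔ ∀ μ : ℂ, IsComplexEigenvalue G μ → μ₀.re ≤ μ.re :=
  ⟨fun h _ hμ => le_re_of_gradientPlayExpStable hG h.1 hμ,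
    fun h => ⟨gradientPlayExpStable_of_le_re hG hpos h,
      fun _ hs => le_re_of_gradientPlayExpStable hG hs hμ₀⟩⟩

theorem exists_gradientPlayDecayRate (hG : G * Gᵀ = Gᵀ * G) {μ₀ : ℂ}
    (hμ₀ : IsComplexEigenvalue G μ₀)
    (hpos : ∀ μ : ℂ, IsComplexEigenvalue G μ → 0 < μ.re) : ∃ r : ℝ, GradientPlayDecayRate G r := by
  have hfin : {μ : ℂ | IsComplexEigenvalue G μ}.Finite := Module.End.finite_hasEigenvalue _
  obtain ⟨μ, hμ, hmin⟩ := Set.exists_min_image _ Complex.re hfin ⟨μ₀, hμ₀⟩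
  exact ⟨μ.re, (gradientPlayDecayRate_iff hG hμ (hpos μ hμ)).2 hmin⟩

end GradientPlay

/-! ### Instability of the accelerated dynamics -/

section NAGD

variable {N : ℕ} {G : Matrix (Fin N) (Fin N) ℝ}

/-- The real-linear map `y ↦ Re (y u)`. -/
noncomputable def realPartCLM (u : Fin N → ℂ) : ℂ →L[ℝ] EuclideanSpace ℝ (Fin N) :=
  LinearMap.toContinuousLinearMap
    { toFun := fun y => WithLp.toLp 2 fun i => (y * u i).re
      map_add' := fun x y => by
        ext i
        simp [add_mul]
      map_smul' := fun c x => by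
        ext i
        simp
        ring }

theorem realPartCLM_apply (u : Fin N → ℂ) (y : ℂ) (i : Fin N) :
    realPartCLM u y i = (y * u i).re := rfl

theorem realPartCLM_mul {μ : ℂ} {u : Fin N → ℂ}
    (hu : G.map (fun r : ℝ => (r : ℂ)) *ᵥ u = μ • u) (y : ℂ) :
    realPartCLM u (μ * y) = WithLp.toLp 2 (G *ᵥ (realPartCLM u y).ofLp) := by
  ext i
  have h := congrFun hu i
  simp only [Matrix.mulVec, dotProduct, Matrix.map_apply, Pi.smul_apply, smul_eq_mul] at h
  rw [realPartCLM_apply, mul_right_comm, ← h, Finset.sum_mul, Complex.re_sum]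
  simp only [Matrix.mulVec, dotProduct]
  refine Finset.sum_congr rfl fun j _ => ?_
  rw [realPartCLM_apply, mul_assoc, Complex.re_ofReal_mul, mul_comm (u j)]

theorem IsScalarNAGD.isNAGD_realPart {μ : ℂ} {t₀ : ℝ} {y z : ℝ → ℂ}
    (h : IsScalarNAGD μ t₀ y z) {u : Fin N → ℂ}
    (hu : G.map (fun r : ℝ => (r : ℂ)) *ᵥ u = μ • u) :
    IsNAGD G t₀ (fun t => realPartCLM u (y t)) (fun t => realPartCLM u (z t)) := fun t ht => by
  refine ⟨(realPartCLM u).hasFDerivAt.comp_hasDerivWithinAt t (h t ht).1,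
    ((realPartCLM u).hasFDerivAt.comp_hasDerivWithinAt t (h t ht).2).congr_deriv ?_⟩
  have h1 : 3 / (t : ℂ) * z t = (3 / t : ℝ) • z t := by
    rw [Complex.real_smul]
    push_cast
    rfl
  rw [map_sub, map_neg, h1, map_smul, realPartCLM_mul hu]

/-- `Re(y u) = (y u + ȳ ū)/2`, and isotropy of `ū` removes the conjugate term. -/
theorem modal_realPartCLM {u : Fin N → ℂ} (hu : star u ⬝ᵥ star u = 0) (y : ℂ) :
    modal u (realPartCLM u y) = y * (star u ⬝ᵥ u) / 2 := by
  have h1 : (fun i => ((realPartCLM u y i : ℝ) : ℂ)) =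
      (y / 2) • u + ((starRingEnd ℂ) y / 2) • star u := by
    ext i
    rw [realPartCLM_apply, Complex.re_eq_add_conj]
    simp
    ring
  rw [modal, h1, dotProduct_add, dotProduct_smul, dotProduct_smul, hu]
  simp
  ring

/-- As `G` is real, `ū` is a right eigenvector for `μ̄`; it is also a left one for `μ ≠ μ̄`, and
such a pair has bilinear product zero. -/
theorem star_dotProduct_star_eq_zero {μ : ℂ} (hμ : μ.im ≠ 0) {u : Fin N → ℂ}
    (hl : star u ᵥ* G.map (fun r : ℝ => (r : ℂ)) = μ • star u)
    (hr : G.map (fun r : ℝ => (r : ℂ)) *ᵥ u = μ • u) : star u ⬝ᵥ star u = 0 := by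
  have h1 : G.map (fun r : ℝ => (r : ℂ)) *ᵥ star u = star μ • star u := by
    ext i
    have h := congrArg star (congrFun hr i)
    simp only [Matrix.mulVec, dotProduct, Matrix.map_apply, Pi.smul_apply, smul_eq_mul, star_sum,
      star_mul', Pi.star_apply, Complex.star_def, Complex.conj_ofReal] at h ⊢
    exact h
  have h2 := Matrix.dotProduct_mulVec (star u) (G.map (fun r : ℝ => (r : ℂ))) (star u)
  rw [h1, hl, dotProduct_smul, smul_dotProduct, ← sub_eq_zero, ← sub_smul, smul_eq_zero] at h2
  refine h2.resolve_left fun h3 => hμ ?_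
  have := congrArg Complex.im h3
  simp at this
  linarith

/-- The initial data for which the modal component along `w` is recessive. -/
noncomputable def modalRecessiveSubspace (μ : ℂ) (t₀ : ℝ) (w : Fin N → ℂ) :
    Submodule ℝ (EuclideanSpace ℝ (Fin N) × EuclideanSpace ℝ (Fin N)) :=
  ((recessiveSubspace μ t₀).restrictScalars ℝ).comap
    ((modalCLM w).toLinearMap.prodMap (modalCLM w).toLinearMap)

theorem mem_modalRecessiveSubspace {μ : ℂ} {t₀ : ℝ} {w : Fin N → ℂ}
    {p : EuclideanSpace ℝ (Fin N) × EuclideanSpace ℝ (Fin N)} :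
    p ∈ modalRecessiveSubspace μ t₀ w ↔ (modal w p.1, modal w p.2) ∈ recessiveSubspace μ t₀ :=
  Iff.rfl

/-- The recessive subspace is complex, so the data `(w*x, 0)` and `(0, w*x)` with one `x` such that
`w*x ≠ 0` already span `ℂ × ℂ`. -/
theorem modalRecessiveSubspace_ne_top {μ s : ℂ} {t₀ : ℝ} (ht₀ : 0 < t₀) (hμ : μ.im ≠ 0)
    (hs : s ^ 2 = -μ) (hre : 0 < s.re) {w : Fin N → ℂ} (hw : w ≠ 0) :
    modalRecessiveSubspace μ t₀ w ≠ ⊤ := by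
  intro htop
  refine recessiveSubspace_ne_top ht₀ hμ hs hre (eq_top_iff.2 fun p _ => ?_)
  obtain ⟨x, hx⟩ := exists_modal_ne_zero hw
  have h0 : modal w 0 = 0 := map_zero (modalCLM w)
  have h1 : (modal w x, modal w 0) ∈ recessiveSubspace μ t₀ :=
    mem_modalRecessiveSubspace (p := (x, 0)).1 (htop ▸ Submodule.mem_top)
  have h2 : (modal w 0, modal w x) ∈ recessiveSubspace μ t₀ :=
    mem_modalRecessiveSubspace (p := (0, x)).1 (htop ▸ Submodule.mem_top)
  have h3 := add_mem (Submodule.smul_mem _ (p.1 / modal w x) h1)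
    (Submodule.smul_mem _ (p.2 / modal w x) h2)
  convert h3
  ext <;> simp [h0, hx]

theorem IsNAGD.modal_isTheta {t₀ : ℝ} {q v : ℝ → EuclideanSpace ℝ (Fin N)}
    (h : IsNAGD G t₀ q v) (ht₀ : 0 < t₀) {μ s : ℂ} (hs : s ^ 2 = -μ) (hre : 0 < s.re)
    {w : Fin N → ℂ} (hw : IsLeftEigenvector G μ w)
    (hmem : (q t₀, v t₀) ∉ modalRecessiveSubspace μ t₀ w) :
    (fun t => ‖modal w (q t)‖) =Θ[atTop] dampedExp s.re :=
  ((h.isScalarNAGD_modal hw).isTheta_of_notMem ht₀ hs hre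
    (fun hm => hmem (mem_modalRecessiveSubspace.2 hm))).norm_left

theorem norm_modal_isBigO (w : Fin N → ℂ) (q : ℝ → EuclideanSpace ℝ (Fin N)) :
    (fun t => modal w (q t)) =O[atTop] fun t => ‖q t‖ :=
  IsBigO.of_bound ‖modalCLM w‖ (Eventually.of_forall fun t => by
    simpa using (modalCLM w).le_opNorm (q t))

/-- The lower bound holds because the component along `u` returns `y` times the nonzero constant
`|u|²/2`. -/
theorem norm_realPart_isTheta {u : Fin N → ℂ} (h0 : u ≠ 0) (hu : star u ⬝ᵥ star u = 0)
    (y : ℝ → ℂ) : (fun t => ‖realPartCLM u (y t)‖) =Θ[atTop] y := by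
  constructor
  · exact (IsBigO.of_bound ‖realPartCLM u‖ (Eventually.of_forall fun t =>
      (realPartCLM u).le_opNorm (y t))).norm_left
  · have h1 := norm_modal_isBigO u fun t => realPartCLM u (y t)
    have hne : star u ⬝ᵥ u ≠ 0 := by
      open scoped ComplexOrder in
      exact fun h => h0 (dotProduct_star_self_eq_zero.1 h)
    simp only [modal_realPartCLM hu, mul_div_assoc] at h1
    simpa only [mul_comm (y _), isBigO_const_mul_left_iff (div_ne_zero hne two_ne_zero)] using h1

theorem exists_small_isNAGD (hG : G * Gᵀ = Gᵀ * G) {μ s : ℂ} (hev : IsComplexEigenvalue G μ)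
    (hμ : μ.im ≠ 0) (hs : s ^ 2 = -μ) (hre : 0 < s.re) {t₀ : ℝ} (ht₀ : 0 < t₀) {ε : ℝ}
    (hε : 0 < ε) : ∃ q v : ℝ → EuclideanSpace ℝ (Fin N), IsNAGD G t₀ q v ∧
      ‖q t₀‖ + ‖v t₀‖ < ε ∧ (fun t => ‖q t‖) =Θ[atTop] dampedExp s.re := by
  obtain ⟨u, h0, hu⟩ := (isComplexEigenvalue_iff μ).1 hev
  have hl := ((isLeftEigenvector_iff hG μ u).2 ⟨h0, hu⟩).2
  set K := ‖realPartCLM u (regularSolution μ t₀)‖ + ‖realPartCLM u (regularVelocity μ t₀)‖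
  have hK : 0 ≤ K := by positivity
  -- Linearity allows the regular solution to be rescaled to initial size `cK < ε`; the `+ 1` avoids
  -- division by zero.
  set c : ℝ := ε / (K + 1)
  have hc : 0 < c := by positivity
  refine ⟨_, _, ((isScalarNAGD_regularSolution μ ht₀).const_mul (c : ℂ)).isNAGD_realPart hu,
    ?_, ?_⟩
  · simp only [← Complex.real_smul, map_smul, norm_smul, ← mul_add]
    rw [Real.norm_of_nonneg hc.le, div_mul_eq_mul_div, div_lt_iff₀ (by positivity)]
    nlinarith
  · refine (norm_realPart_isTheta h0 (star_dotProduct_star_eq_zero hμ hl hu) _).trans ?_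
    exact (isTheta_const_mul_left (Complex.ofReal_ne_zero.2 hc.ne')).2
      (regularSolution_isTheta hμ hs hre)

theorem nagdExpUnstable (hG : G * Gᵀ = Gᵀ * G) {μ s : ℂ} (hev : IsComplexEigenvalue G μ)
    (hμ : μ.im ≠ 0) (hs : s ^ 2 = -μ) (hre : 0 < s.re) {t₀ : ℝ} (ht₀ : 0 < t₀) :
    NAGDExpUnstable G t₀ s.re := by
  have hsmall := fun ε (hε : (0 : ℝ) < ε) => exists_small_isNAGD hG hev hμ hs hre ht₀ hε
  refine ⟨hre, fun hst => ?_, hsmall, ?_⟩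
  · obtain ⟨δ, hδ, hb⟩ := hst 1 one_pos
    obtain ⟨q, v, hqv, hlt, hΘ⟩ := hsmall δ hδ
    have h1 : Tendsto (fun t => ‖‖q t‖‖) atTop atTop :=
      hΘ.tendsto_norm_atTop_iff.2 (tendsto_norm_atTop_atTop.comp (tendsto_dampedExp_atTop hre))
    obtain ⟨t, h2, h3⟩ := ((h1.eventually_gt_atTop 1).and (eventually_ge_atTop t₀)).exists
    have h4 := hb q v hqv hlt t h3
    rw [norm_norm] at h2
    linarith [norm_nonneg (v t)]
  · obtain ⟨w, hw⟩ := (isComplexEigenvalue_iff μ).1 hev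
    have hl := (isLeftEigenvector_iff hG μ w).2 hw
    refine ⟨modalRecessiveSubspace μ t₀ w,
      modalRecessiveSubspace_ne_top ht₀ hμ hs hre hw.1, fun q v h hmem => ?_⟩
    exact (h.modal_isTheta ht₀ hs hre hl hmem).2.trans (norm_modal_isBigO w q).norm_left

/-- Mode by mode: the energy bound covers `Re s = 0` too, so only `μ = 0` needs the explicit
solution, whose bounded growth is below `dampedExp β`. -/
theorem IsNAGD.norm_isBigO (hG : G * Gᵀ = Gᵀ * G) {t₀ : ℝ}
    {q v : ℝ → EuclideanSpace ℝ (Fin N)} (h : IsNAGD G t₀ q v) (ht₀ : 0 < t₀) {β : ℝ}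
    (hβ : 0 < β) (hmax : ∀ μ : ℂ, IsComplexEigenvalue G μ → imSqrt μ ≤ β) :
    (fun t => ‖q t‖) =O[atTop] dampedExp β := by
  have key : ∀ w : Fin N → ℂ, (fun t => modal w (q t)) =O[atTop] dampedExp β := by
    refine induction_on_leftEigenvectors hG ?_ ?_ ?_
    · simp only [modal_zero_left]
      exact isBigO_zero _ _
    · intro w w' hw hw'
      simp only [modal_add_left]
      exact hw.add hw'
    · intro μ w hμ hw
      have hy := h.isScalarNAGD_modal hw
      by_cases h0 : μ = 0
      · subst h0
        exact (hy.isBigO_one ht₀).trans (one_isBigO_dampedExp hβ)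
      obtain ⟨s, hs, hre⟩ := exists_sq_eq_neg_re_eq_imSqrt μ
      have hs0 : s ≠ 0 := by
        rintro rfl
        simp [eq_comm, h0] at hs
      have hre0 : 0 ≤ s.re := hre ▸ abs_nonneg _
      exact (hy.isBigO ht₀ hs hs0 hre0).trans (dampedExp_isBigO_of_le (hre ▸ hmax μ hμ))
  refine IsBigO.trans (IsBigO.of_bound 1 (Eventually.of_forall fun t => ?_))
    (IsBigO.sum fun i (_ : i ∈ Finset.univ) => (key (Pi.single i 1)).norm_left)
  rw [norm_norm, one_mul, Finset.sum_apply]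
  exact (norm_le_sum_modal (q t)).trans (Real.le_norm_self _)

end NAGD

theorem mainTheorem6 {N : ℕ} (G : Matrix (Fin N) (Fin N) ℝ) (hG : G * Gᵀ = Gᵀ * G)
    (a b : ℝ) (ha : 0 < a) (hb : b ≠ 0)
    (hev : IsComplexEigenvalue G ((a : ℂ) + (b : ℂ) * Complex.I)) :
    -- first-order gradient play: the mode of the given eigenvalue decays at rate exactly `a`
    (∀ w : Fin N → ℂ, IsLeftEigenvector G ((a : ℂ) + (b : ℂ) * Complex.I) w →
      ∀ x : ℝ → EuclideanSpace ℝ (Fin N), IsGradientPlay G x → ∀ t : ℝ, 0 ≤ t →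
        ‖modal w (x t)‖ = Real.exp (-a * t) * ‖modal w (x 0)‖) ∧
    -- the whole system is exponentially stable with rate `a` iff `a` is the least real part
    (GradientPlayDecayRate G a ↔ ∀ μ : ℂ, IsComplexEigenvalue G μ → a ≤ μ.re) ∧
    -- it is exponentially stable as soon as all real parts are positive
    ((∀ μ : ℂ, IsComplexEigenvalue G μ → 0 < μ.re) → ∃ r : ℝ, GradientPlayDecayRate G r) ∧
    -- the value of the growth rate
    imSqrt ((a : ℂ) + (b : ℂ) * Complex.I) = √((√(a ^ 2 + b ^ 2) - a) / 2) ∧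
    ∀ t₀ : ℝ, 0 < t₀ →
      -- the NAGD dynamics are exponentially unstable with that growth rate
      NAGDExpUnstable G t₀ (imSqrt ((a : ℂ) + (b : ℂ) * Complex.I)) ∧
      -- the mode of the given eigenvalue grows generically at exactly that rate
      (∀ w : Fin N → ℂ, IsLeftEigenvector G ((a : ℂ) + (b : ℂ) * Complex.I) w →
        ∃ S : Submodule ℝ (EuclideanSpace ℝ (Fin N) × EuclideanSpace ℝ (Fin N)), S ≠ ⊤ ∧
          ∀ q v : ℝ → EuclideanSpace ℝ (Fin N), IsNAGD G t₀ q v → (q t₀, v t₀) ∉ S →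
            (fun t => ‖modal w (q t)‖) =Θ[atTop]
              dampedExp (imSqrt ((a : ℂ) + (b : ℂ) * Complex.I))) ∧
      -- no trajectory grows faster if no other eigenvalue gives a larger rate
      ((∀ μ : ℂ, IsComplexEigenvalue G μ →
          imSqrt μ ≤ imSqrt ((a : ℂ) + (b : ℂ) * Complex.I)) →
        ∀ q v : ℝ → EuclideanSpace ℝ (Fin N), IsNAGD G t₀ q v →
          (fun t => ‖q t‖) =O[atTop] dampedExp (imSqrt ((a : ℂ) + (b : ℂ) * Complex.I))) := by
  set μ : ℂ := (a : ℂ) + (b : ℂ) * Complex.I with hμdef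
  have hre : μ.re = a := by simp [hμdef]
  have him : μ.im ≠ 0 := by simpa [hμdef] using hb
  obtain ⟨s, hs, hsre⟩ := exists_sq_eq_neg_re_eq_imSqrt μ
  have hβ : 0 < imSqrt μ := imSqrt_pos a hb
  have hspos : 0 < s.re := hsre ▸ hβ
  refine ⟨fun w hw x hx t ht => ?_, ?_, exists_gradientPlayDecayRate hG hev,
    imSqrt_eq_sqrt a b, fun t₀ ht₀ => ⟨?_, fun w hw => ?_, fun hmax q v h => ?_⟩⟩
  · rw [hx.norm_modal_eq hw ht, hre]
  · simpa only [hre] using gradientPlayDecayRate_iff hG hev (hre.symm ▸ ha)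
  · exact hsre ▸ nagdExpUnstable hG hev him hs hspos ht₀
  · exact ⟨modalRecessiveSubspace μ t₀ w, modalRecessiveSubspace_ne_top ht₀ him hs hspos hw.1,
      fun q v h hmem => hsre ▸ h.modal_isTheta ht₀ hs hspos hw hmem⟩
  · exact h.norm_isBigO hG ht₀ hβ hmax
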